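/- Let $p$ be a prime, let $n \ge 5$, and let $\alpha\in\overline{\mathbb F_p}^{\times}$ have multiplicative order $e>n$. Put $\mathbb F_q=\mathbb F_p(\alpha)$ and assume that $\mathbb F_p(\alpha)=\mathbb F_p(\alpha+\alpha^{-1})$. Let $B_n$ be the braid group on $n$ strands, with Artin generators $\sigma_1,\dots,\sigma_{n-1}$, and let $H_n(\alpha)$ be the Hecke algebra, that is, the quotient of $\mathbb F_qB_n$ by the relations $(\sigma_i+1)(\sigma_i-\alpha)=0$; it is split semisimple because $e>n$. For $0\le r\le n/2$ let $c(n,r)$ be the number of standard Young tableaux of shape $[n-r,r]$, and let the representation of $B_n$ associated to $[n-r,r]$ be the irreducible representation of $H_n(\alpha)$ (of dimension $c(n,r)$) attached to this partition, normalized so that $[n]$ corresponds to $\sigma_i\mapsto -1$. Explicitly (Young's seminormal form), it has a basis $(v_T)$ indexed by the standard tableaux $T$ of shape $[n-r,r]$, and $$\sigma_i v_T = a_i(T)\,v_T+(1+a_i(T))\,v_{s_iT},\qquad a_i(T)=\frac{\alpha-1}{1-\alpha^{\,\mathrm{ct}_T(i+1)-\mathrm{ct}_T(i)}},$$ where $\mathrm{ct}_T(j)$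 is the content (column minus row) of the box of $T$ containing $j$, $s_iT$ is $T$ with $i$ and $i+1$ exchanged, and $v_{s_iT}=0$ if $s_iT$ is not standard. Let $r_1\ne r_2$ with $0\le r_1,r_2\le n/2$, let $N_i=c(n,r_i)$, and let $R_i:B_n\to \mathrm{GL}_{N_i}(\mathbb F_q)$ be the representation associated to $[n-r_i,r_i]$, written in any basis. If $R_i(B_n)\supseteq \mathrm{SL}_{N_i}(\mathbb F_q)$ for $i=1,2$, then the image of $R=R_1\oplus R_2:B_n\to \mathrm{GL}_{N_1}(\mathbb F_q)\times \mathrm{GL}_{N_2}(\mathbb F_q)$ contains $\mathrm{SL}_{N_1}(\mathbb F_q)\times \mathrm{SL}_{N_2}(\mathbb F_q)$. -/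

import Mathlib

namespace BraidTL

/-! ## The braid group -/

/-- The Artin relations between the generators `σ_0, …, σ_{n-2}` of the braid group on `n` strands:
`σ_i σ_j σ_i = σ_j σ_i σ_j` for `j = i + 1`, and `σ_i σ_j = σ_j σ_i` for `j ≥ i + 2`. -/
def braidRels (n : ℕ) : Set (FreeGroup (Fin (n - 1))) :=
  {x | ∃ i j : Fin (n - 1),
    ((j : ℕ) = i + 1 ∧ x = (FreeGroup.of i * FreeGroup.of j * FreeGroup.of i) *
      (FreeGroup.of j * FreeGroup.of i * FreeGroup.of j)⁻¹) ∨
    ((i : ℕ) + 2 ≤ j ∧ x = (FreeGroup.of i * FreeGroup.of j) *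
      (FreeGroup.of j * FreeGroup.of i)⁻¹)}

/-- The braid group on `n` strands, by Artin's presentation. -/
abbrev BraidGroup (n : ℕ) : Type := PresentedGroup (braidRels n)

/-- The Artin generator exchanging the (0-based) strands `i` and `i + 1`. -/
def BraidGroup.σ {n : ℕ} (i : Fin (n - 1)) : BraidGroup n := PresentedGroup.of i

/-! ## Standard tableaux with at most two rows

A filling of a two-row diagram by the entries `0, …, n-1` which increases along the rows is recorded
by the function `w : Fin n → Bool` with `w j = false` if `j` is in the first row and `w j = true` if
`j` is in the second row. -/

/-- The number of entries `< k` in the row `b`. -/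
def rowCount {n : ℕ} (w : Fin n → Bool) (b : Bool) (k : ℕ) : ℕ :=
  (Finset.univ.filter fun j : Fin n => (j : ℕ) < k ∧ w j = b).card

/-- `w` is a standard tableau of shape `[n - r, r]`: the second row has `r` entries, and for every
`k` the entries `< k` form a Young diagram. -/
def IsStandard {n : ℕ} (r : ℕ) (w : Fin n → Bool) : Prop :=
  rowCount w true n = r ∧ ∀ k ≤ n, rowCount w true k ≤ rowCount w false k

instance {n : ℕ} (r : ℕ) (w : Fin n → Bool) : Decidable (IsStandard r w) :=
  inferInstanceAs (Decidable (_ ∧ _))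

/-- The standard tableaux of shape `[n - r, r]`. -/
abbrev StdTableau (n r : ℕ) : Type := {w : Fin n → Bool // IsStandard r w}

/-- The number of standard tableaux of shape `[n - r, r]`. -/
def c (n r : ℕ) : ℕ := Fintype.card (StdTableau n r)

/-- The content (column index minus row index) of the box which contains the entry `j`. -/
def content {n : ℕ} (w : Fin n → Bool) (j : Fin n) : ℤ :=
  (rowCount w (w j) j : ℤ) - (if w j then 1 else 0)

/-- The entry `i`, for `i < n - 1`. -/
def lo {n : ℕ} (i : Fin (n - 1)) : Fin n := ⟨i, by omega⟩

/-- The entry `i + 1`, for `i < n - 1`. -/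
def hi {n : ℕ} (i : Fin (n - 1)) : Fin n := ⟨i + 1, by omega⟩

/-- The filling obtained from `w` by exchanging the entries `i` and `i + 1`. (If these are in the
same row, the exchanged filling is not standard; here it would be represented by `w` again, but it
then only ever occurs with the coefficient `0`.) -/
def swapEntries {n : ℕ} (i : Fin (n - 1)) (w : Fin n → Bool) : Fin n → Bool :=
  fun j => w (Equiv.swap (lo i) (hi i) j)

/-! ## The representations of the Hecke algebra attached to two-row partitions -/

section Aux

variable {K A : Type*} [Field K] [Ring A] [Algebra K A] {a : K}

lemma quadratic_of_sq (e s : A) (hs : e = s + 1) (h : e * e = (1 + a) • e) :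
    (s + 1) * (s - algebraMap K A a) = 0 := by
  have e1 : s - algebraMap K A a = e - (1 + a) • (1 : A) := by
    rw [hs, Algebra.algebraMap_eq_smul_one, add_smul, one_smul]; abel
  rw [e1, ← hs, mul_sub, h, mul_smul_comm, mul_one, sub_self]

lemma braid_of_tl (e f s t : A) (hs : e = s + 1) (ht : f = t + 1) (h1 : e * f * e = a • e)
    (h2 : f * e * f = a • f) (h3 : e * e = (1 + a) • e) (h4 : f * f = (1 + a) • f) :
    s * t * s = t * s * t := by
  have ei : s = e - 1 := by rw [hs, add_sub_cancel_right]
  have ej : t = f - 1 := by rw [ht, add_sub_cancel_right]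
  rw [ei, ej]
  simp only [sub_mul, mul_sub, one_mul, mul_one, h1, h2, h3, h4, add_smul, one_smul]
  abel

lemma comm_of_comm (e f s t : A) (hs : e = s + 1) (ht : f = t + 1) (h : e * f = f * e) :
    s * t = t * s := by
  have ei : s = e - 1 := by rw [hs, add_sub_cancel_right]
  have ej : t = f - 1 := by rw [ht, add_sub_cancel_right]
  rw [ei, ej]
  simp only [sub_mul, mul_sub, one_mul, mul_one, h]
  abel

lemma isUnit_of_sq (e s : A) (hs : e = s + 1) (ha : a ≠ 0) (h : e * e = (1 + a) • e) :
    IsUnit s := by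
  have ei : s = e - 1 := by rw [hs, add_sub_cancel_right]
  have key : s * (e - a • 1) = a • 1 := by
    rw [ei]
    simp only [sub_mul, mul_sub, one_mul, mul_one, h, mul_smul_comm, add_smul, one_smul, smul_sub]
    abel
  have key' : (e - a • 1) * s = a • 1 := by
    rw [ei]
    simp only [sub_mul, mul_sub, one_mul, mul_one, h, smul_mul_assoc, add_smul, one_smul]
    abel
  refine ⟨⟨s, a⁻¹ • (e - a • 1), ?_, ?_⟩, rfl⟩
  · rw [mul_smul_comm, key, smul_smul, inv_mul_cancel₀ ha, one_smul]
  · rw [smul_mul_assoc, key', smul_smul, inv_mul_cancel₀ ha, one_smul]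

end Aux

section Rep

variable {K : Type*} [Field K] {n r : ℕ}

/-- The basis vector `v_w` if `w` is a standard tableau, and `0` otherwise. -/
noncomputable def vec (K : Type*) [Field K] {n : ℕ} (r : ℕ) (w : Fin n → Bool) :
    StdTableau n r →₀ K :=
  if h : IsStandard r w then Finsupp.single ⟨w, h⟩ 1 else 0

/-- The diagonal coefficient `(α - 1) / (1 - α ^ (ct(i+1) - ct(i)))` of Young's seminormal form,
where `ct` is the content. It is `-1` if `i` and `i + 1` are in the same row, and `α` if they are in
the same column. -/
noncomputable def diagCoeff (α : Kˣ) (i : Fin (n - 1)) (w : Fin n → Bool) : K :=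
  ((α : K) - 1) / (1 - (α : K) ^ (content w (hi i) - content w (lo i)))

/-- The action of the generator `σ_i` on the seminormal basis:
`σ_i v_w = a v_w + (1 + a) v_{s_i w}` with `a = diagCoeff α i w`, where `v_{s_i w} = 0` if `s_i w` is
not standard. -/
noncomputable def heckeOp (α : Kˣ) (r : ℕ) (i : Fin (n - 1)) : Module.End K (StdTableau n r →₀ K) :=
  Finsupp.linearCombination K fun w =>
    diagCoeff α i w.1 • vec K r w.1 + (1 + diagCoeff α i w.1) • vec K r (swapEntries i w.1)

lemma rowCount_succ (w : Fin n → Bool) (b : Bool) (k : Fin n) :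
    rowCount w b (k + 1) = rowCount w b k + if w k = b then 1 else 0 := by
  unfold rowCount
  split_ifs with h
  · rw [← Finset.card_insert_of_notMem (a := k) (by simp)]
    refine congrArg Finset.card (Finset.ext fun j => ?_)
    simp only [Finset.mem_filter, Finset.mem_univ, true_and, Finset.mem_insert]
    constructor
    · rintro ⟨h1, h2⟩
      by_cases hjk : j = k
      · exact Or.inl hjk
      · right
        exact ⟨by have : (j : ℕ) ≠ k := fun h => hjk (Fin.ext h)
                  omega, h2⟩
    · rintro (rfl | ⟨h1, h2⟩)
      · exact ⟨by omega, h⟩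
      · exact ⟨by omega, h2⟩
  · refine Eq.trans ?_ (Nat.add_zero _).symm
    refine congrArg Finset.card (Finset.ext fun j => ?_)
    simp only [Finset.mem_filter, Finset.mem_univ, true_and]
    constructor
    · rintro ⟨h1, h2⟩
      have : (j : ℕ) ≠ k := fun hh => h (by rw [← Fin.ext hh]; exact h2)
      exact ⟨by omega, h2⟩
    · rintro ⟨h1, h2⟩
      exact ⟨by omega, h2⟩

lemma rowCount_add (w : Fin n → Bool) (k : ℕ) (hk : k ≤ n) :
    rowCount w false k + rowCount w true k = k := by
  induction k with
  | zero => simp [rowCount]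
  | succ k ih =>
    have h0 := rowCount_succ w false ⟨k, by omega⟩
    have h1 := rowCount_succ w true ⟨k, by omega⟩
    simp only at h0 h1
    rw [h0, h1]
    have := ih (by omega)
    cases w ⟨k, by omega⟩ <;> simp <;> omega

lemma swap_val (i : Fin (n - 1)) (j : Fin n) :
    ((Equiv.swap (lo i) (hi i) j : Fin n) : ℕ) =
      if (j : ℕ) = i then (i : ℕ) + 1 else if (j : ℕ) = i + 1 then (i : ℕ) else j := by
  rw [Equiv.swap_apply_def]
  simp only [lo, hi, Fin.ext_iff]
  split_ifs <;> simp

lemma rowCount_swap (i : Fin (n - 1)) (w : Fin n → Bool) (b : Bool) (k : ℕ) (hk : k ≠ i + 1) :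
    rowCount (swapEntries i w) b k = rowCount w b k := by
  unfold rowCount swapEntries
  refine Finset.card_equiv (Equiv.swap (lo i) (hi i)) fun j => ?_
  simp only [Finset.mem_filter, Finset.mem_univ, true_and, swap_val]
  refine and_congr_left fun _ => ?_
  split_ifs <;> omega

lemma swapEntries_of_ne (i : Fin (n - 1)) (w : Fin n → Bool) (j : Fin n)
    (h1 : (j : ℕ) ≠ i) (h2 : (j : ℕ) ≠ i + 1) : swapEntries i w j = w j := by
  unfold swapEntries
  congr 1
  apply Fin.ext
  rw [swap_val, if_neg h1, if_neg h2]

@[simp] lemma swapEntries_lo (i : Fin (n - 1)) (w : Fin n → Bool) :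
    swapEntries i w (lo i) = w (hi i) := by simp [swapEntries]

@[simp] lemma swapEntries_hi (i : Fin (n - 1)) (w : Fin n → Bool) :
    swapEntries i w (hi i) = w (lo i) := by simp [swapEntries]

@[simp] lemma swapEntries_swapEntries (i : Fin (n - 1)) (w : Fin n → Bool) :
    swapEntries i (swapEntries i w) = w := by
  funext j; simp [swapEntries]

lemma swapEntries_same (i : Fin (n - 1)) (w : Fin n → Bool) (h : w (lo i) = w (hi i)) :
    swapEntries i w = w := by
  funext j
  unfold swapEntries
  rw [Equiv.swap_apply_def]
  split_ifs with h1 h2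
  · rw [h1, h]
  · rw [h2, h]
  · rfl

lemma swapEntries_comm (i j : Fin (n - 1)) (hij : (i : ℕ) + 2 ≤ j) (w : Fin n → Bool) :
    swapEntries i (swapEntries j w) = swapEntries j (swapEntries i w) := by
  funext k
  unfold swapEntries
  congr 1
  apply Fin.ext
  simp only [swap_val]
  split_ifs <;> omega

/-- The difference of the numbers of entries `< k` in the first and in the second row. -/
def height (w : Fin n → Bool) (k : ℕ) : ℤ := (rowCount w false k : ℤ) - rowCount w true k

lemma height_succ (w : Fin n → Bool) (k : Fin n) :
    height w (k + 1) = height w k + if w k then -1 else 1 := by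
  unfold height
  rw [rowCount_succ, rowCount_succ]
  cases w k <;> simp <;> ring

lemma height_swap (i : Fin (n - 1)) (w : Fin n → Bool) (k : ℕ) (hk : k ≠ i + 1) :
    height (swapEntries i w) k = height w k := by
  unfold height
  rw [rowCount_swap _ _ _ _ hk, rowCount_swap _ _ _ _ hk]

lemma content_sub (i : Fin (n - 1)) (w : Fin n → Bool) :
    content w (hi i) - content w (lo i) =
      if w (lo i) = w (hi i) then 1
      else if w (hi i) then -(height w i + 1) else height w i + 1 := by
  have h := fun b => rowCount_succ w b (lo i)
  have e1 : ((hi i : Fin n) : ℕ) = ((lo i : Fin n) : ℕ) + 1 := rfl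
  have e2 : ((lo i : Fin n) : ℕ) = i := rfl
  unfold content height
  rw [e1, h, e2]
  cases w (lo i) <;> cases w (hi i) <;> simp <;> ring

/-- The coefficient of `σ_i + 1`. -/
noncomputable def coef (α : Kˣ) (i : Fin (n - 1)) (w : Fin n → Bool) : K := 1 + diagCoeff α i w

lemma zpow_ne_one (α : Kˣ) (hα : n < orderOf α) (d : ℤ) (h0 : 0 < d) (hd : d ≤ n) :
    (α : K) ^ d ≠ 1 := by
  intro h
  have h' : α ^ d = 1 := by
    apply Units.ext
    push_cast
    exact h
  rw [← orderOf_dvd_iff_zpow_eq_one] at h'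
  have := Int.le_of_dvd h0 h'
  omega

lemma coef_same (α : Kˣ) (hα : n < orderOf α) (i : Fin (n - 1)) (w : Fin n → Bool)
    (h : w (lo i) = w (hi i)) : coef α i w = 0 := by
  have h1 := zpow_ne_one (n := n) α hα 1 (by norm_num) (by have := i.2; omega)
  rw [zpow_one] at h1
  have h2 : (1 : K) - α ≠ 0 := sub_ne_zero.mpr (Ne.symm h1)
  unfold coef diagCoeff
  rw [content_sub, if_pos h, zpow_one]
  field_simp
  ring

lemma coef_ft (α : Kˣ) (hα : n < orderOf α) (i : Fin (n - 1)) (w : Fin n → Bool) (m : ℕ)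
    (hm : height w i = m) (hmn : m + 1 ≤ n) (h1 : w (lo i) = false) (h2 : w (hi i) = true) :
    coef α i w = ((α : K) ^ (m + 2) - 1) / ((α : K) ^ (m + 1) - 1) := by
  have h3 := zpow_ne_one (n := n) α hα (m + 1 : ℕ) (by positivity) (by omega)
  rw [zpow_natCast] at h3
  have h4 : (α : K) ^ (m + 1) - 1 ≠ 0 := sub_ne_zero.mpr h3
  have h5 : (α : K) ≠ 0 := α.ne_zero
  unfold coef diagCoeff
  rw [content_sub, h1, h2, hm]
  simp only [Bool.false_eq_true, if_false, if_true]
  rw [show (-((m : ℤ) + 1)) = -((m + 1 : ℕ) : ℤ) by push_cast; ring, zpow_neg, zpow_natCast]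
  have h6 : (1 : K) - ((α : K) ^ (m + 1))⁻¹ ≠ 0 := by
    intro h
    apply h3
    have : ((α : K) ^ (m + 1))⁻¹ = 1 := (sub_eq_zero.mp h).symm
    exact inv_eq_one.mp this
  rw [eq_div_iff h4]
  have h7 : (1 : K) - ((α : K) ^ (m + 1))⁻¹ = ((α : K) ^ (m + 1) - 1) / (α : K) ^ (m + 1) := by
    field_simp
  rw [h7]
  field_simp
  ring

lemma coef_tf (α : Kˣ) (hα : n < orderOf α) (i : Fin (n - 1)) (w : Fin n → Bool) (m : ℕ)
    (hm : height w i = m) (hmn : m + 1 ≤ n) (h1 : w (lo i) = true) (h2 : w (hi i) = false) :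
    coef α i w = ((α : K) ^ (m + 1) - α) / ((α : K) ^ (m + 1) - 1) := by
  have h3 := zpow_ne_one (n := n) α hα (m + 1 : ℕ) (by positivity) (by omega)
  rw [zpow_natCast] at h3
  have h4 : (α : K) ^ (m + 1) - 1 ≠ 0 := sub_ne_zero.mpr h3
  have h5 : (1 : K) - (α : K) ^ (m + 1) ≠ 0 := sub_ne_zero.mpr (Ne.symm h3)
  unfold coef diagCoeff
  rw [content_sub, h1, h2, hm]
  simp only [Bool.true_eq_false, Bool.false_eq_true, if_false]
  rw [show ((m : ℤ) + 1) = ((m + 1 : ℕ) : ℤ) by push_cast; ring, zpow_natCast]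
  rw [eq_div_iff h4, ← neg_sub ((α : K) ^ (m + 1)) 1]
  field_simp
  ring

lemma vec_swap_eq_zero (i : Fin (n - 1)) (w : Fin n → Bool) (hw : ¬ IsStandard r w)
    (hs : IsStandard r (swapEntries i w)) :
    w (lo i) = true ∧ w (hi i) = false ∧ height w i = 0 := by
  obtain ⟨hs1, hs2⟩ := hs
  have hi2 := i.2
  rw [rowCount_swap _ _ _ _ (by omega)] at hs1
  have key : ¬ rowCount w true (i + 1) ≤ rowCount w false (i + 1) := by
    intro hle
    refine hw ⟨hs1, fun k hk => ?_⟩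
    by_cases hki : k = i + 1
    · rw [hki]; exact hle
    · have := hs2 k hk
      rwa [rowCount_swap _ _ _ _ hki, rowCount_swap _ _ _ _ hki] at this
  have a0 := hs2 i (by omega)
  rw [rowCount_swap _ _ _ _ (by omega), rowCount_swap _ _ _ _ (by omega)] at a0
  have a1 := hs2 (i + 1) (by omega)
  have b0 := fun b => rowCount_succ (swapEntries i w) b (lo i)
  have b1 := fun b => rowCount_succ w b (lo i)
  have e2 : ((lo i : Fin n) : ℕ) = i := rfl
  rw [e2] at b0 b1
  rw [b0, b0, rowCount_swap _ _ _ _ (by omega), rowCount_swap _ _ _ _ (by omega),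
    swapEntries_lo] at a1
  rw [b1, b1] at key
  unfold height
  revert a1 key
  cases w (lo i) <;> cases w (hi i) <;> simp <;> omega

/-- The operator `σ_i + 1`. -/
noncomputable def tlOp (α : Kˣ) (r : ℕ) (i : Fin (n - 1)) : Module.End K (StdTableau n r →₀ K) :=
  heckeOp α r i + 1

lemma tlOp_vec (α : Kˣ) (hα : n < orderOf α) (i : Fin (n - 1)) (w : Fin n → Bool) :
    tlOp α r i (vec K r w) = coef α i w • (vec K r w + vec K r (swapEntries i w)) := by
  by_cases hw : IsStandard r w
  · have : vec K r w = Finsupp.single ⟨w, hw⟩ 1 := dif_pos hw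
    rw [tlOp, LinearMap.add_apply, Module.End.one_apply]
    conv_lhs => rw [this]
    rw [heckeOp, Finsupp.linearCombination_single, one_smul, ← this, coef]
    simp only [smul_add, add_smul, one_smul]
    abel
  · have h0 : vec K r w = 0 := dif_neg hw
    rw [h0, map_zero, zero_add]
    by_cases hs : IsStandard r (swapEntries i w)
    · obtain ⟨h1, h2, h3⟩ := vec_swap_eq_zero i w hw hs
      rw [coef_tf α hα i w 0 (by simpa using h3) (by have := i.2; omega) h1 h2]
      simp
    · rw [vec, dif_neg hs, smul_zero]

lemma end_ext {f g : Module.End K (StdTableau n r →₀ K)}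
    (h : ∀ w, IsStandard r w → f (vec K r w) = g (vec K r w)) : f = g := by
  apply Finsupp.lhom_ext'
  intro w
  apply LinearMap.ext_ring
  have := h w.1 w.2
  rw [vec, dif_pos w.2] at this
  exact this

lemma exists_height (w : Fin n → Bool) (hw : IsStandard r w) (k : ℕ) (hk : k ≤ n) :
    ∃ m : ℕ, height w k = m ∧ m ≤ k := by
  have h1 := hw.2 k hk
  have h2 := rowCount_add w k hk
  refine ⟨rowCount w false k - rowCount w true k, ?_, by omega⟩
  unfold height
  omega

lemma coef_add (α : Kˣ) (hα : n < orderOf α) (i : Fin (n - 1)) (w : Fin n → Bool)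
    (h : w (lo i) ≠ w (hi i)) (m : ℕ) (hm : height w i = m) (hmn : m + 1 ≤ n) :
    coef α i w + coef α i (swapEntries i w) = 1 + α := by
  have h3 := zpow_ne_one (n := n) α hα (m + 1 : ℕ) (by positivity) (by omega)
  rw [zpow_natCast] at h3
  have h4 : (α : K) ^ (m + 1) - 1 ≠ 0 := sub_ne_zero.mpr h3
  have hs : height (swapEntries i w) i = m := by rw [height_swap _ _ _ (by omega), hm]
  cases h1 : w (lo i) <;> cases h2 : w (hi i)
  · exact absurd (h1.trans h2.symm) h
  · rw [coef_ft α hα i w m hm hmn h1 h2,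
      coef_tf α hα i _ m hs hmn (by rw [swapEntries_lo, h2]) (by rw [swapEntries_hi, h1])]
    field_simp
    ring
  · rw [coef_tf α hα i w m hm hmn h1 h2,
      coef_ft α hα i _ m hs hmn (by rw [swapEntries_lo, h2]) (by rw [swapEntries_hi, h1])]
    field_simp
    ring
  · exact absurd (h1.trans h2.symm) h

lemma tlOp_sq (α : Kˣ) (hα : n < orderOf α) (i : Fin (n - 1)) :
    tlOp α r i * tlOp α r i = (1 + α : K) • tlOp α r i := by
  refine end_ext fun w hw => ?_
  obtain ⟨m, hm, hmi⟩ := exists_height w hw i (by omega)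
  rw [Module.End.mul_apply, LinearMap.smul_apply, tlOp_vec α hα, map_smul, map_add,
    tlOp_vec α hα, tlOp_vec α hα, swapEntries_swapEntries]
  by_cases h : w (lo i) = w (hi i)
  · rw [coef_same α hα i w h]; simp
  · rw [← coef_add α hα i w h m hm (by omega), add_comm (vec K r (swapEntries i w)), ← add_smul,
      smul_comm]

/-- The quadratic relation `(σ_i + 1) (σ_i - α) = 0` of the Hecke algebra. -/
theorem hecke_quadratic (α : Kˣ) (hα : n < orderOf α) (i : Fin (n - 1)) :
    (heckeOp α r i + 1) * (heckeOp α r i - algebraMap K _ (α : K)) = 0 := by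
  have h := tlOp_sq (r := r) α hα i
  exact quadratic_of_sq (tlOp α r i) (heckeOp α r i) rfl h

lemma coef_mul (α : Kˣ) (hα : n < orderOf α) (i j : Fin (n - 1)) (hij : (j : ℕ) = i + 1)
    (w : Fin n → Bool) (h1 : w (lo i) ≠ w (hi i)) (h2 : w (lo j) ≠ w (hi j))
    (m : ℕ) (hm : height w i = m) (hmi : m ≤ i) (hp : 0 ≤ height w (j + 2)) :
    coef α i w * coef α j w = (α : K) := by
  have hj2 := j.2
  have ez : ∀ k : ℕ, 0 < k → k ≤ n → (α : K) ^ k - 1 ≠ 0 := by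
    intro k hk hkn
    have := zpow_ne_one (n := n) α hα k (by omega) (by omega)
    rw [zpow_natCast] at this
    exact sub_ne_zero.mpr this
  have e1 : hi i = lo j := by apply Fin.ext; simp [hi, lo, hij]
  have g1 : height w j = height w i + if w (lo i) then -1 else 1 := by
    rw [hij]; exact height_succ w (lo i)
  have g2 : height w (j + 1) = height w j + if w (lo j) then -1 else 1 := height_succ w (lo j)
  have g3 : height w (j + 2) = height w (j + 1) + if w (hi j) then -1 else 1 :=
    height_succ w (hi j)
  rw [e1] at h1
  have z1 := ez (m + 1) (by omega) (by omega)
  cases x : w (lo i) <;> cases y : w (lo j) <;> cases z : w (hi j) <;> simp_all only [ne_eq,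
    not_true_eq_false, not_false_eq_true, Bool.true_eq_false, Bool.false_eq_true, if_true, if_false]
  · have z2 := ez (m + 2) (by omega) (by omega)
    rw [coef_ft α hα i w m hm (by omega) x (by rw [e1, y]),
      coef_tf α hα j w (m + 1) (by rw [hij]; push_cast; omega) (by omega) y z,
      show m + 1 + 1 = m + 2 by ring]
    field_simp
    ring
  · obtain ⟨l, rfl⟩ : ∃ l, m = l + 1 := ⟨m - 1, by omega⟩
    have z2 := ez (l + 2) (by omega) (by omega)
    have z3 := ez (l + 1) (by omega) (by omega)
    rw [coef_tf α hα i w (l + 1) hm (by omega) x (by rw [e1, y]),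
      coef_ft α hα j w l (by rw [hij]; push_cast at *; omega) (by omega) y z,
      show l + 1 + 1 = l + 2 by ring]
    field_simp
    ring

lemma height_nonneg (w : Fin n → Bool) (hw : IsStandard r w) (k : ℕ) (hk : k ≤ n) :
    0 ≤ height w k := by
  have := hw.2 k hk
  unfold height
  omega

/-- The Temperley-Lieb relations, for `j = i + 1`. -/
theorem tlOp_tl (α : Kˣ) (hα : n < orderOf α) (i j : Fin (n - 1)) (hij : (j : ℕ) = i + 1) :
    tlOp α r i * tlOp α r j * tlOp α r i = (α : K) • tlOp α r i ∧
    tlOp α r j * tlOp α r i * tlOp α r j = (α : K) • tlOp α r j := by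
  have hj2 := j.2
  have e1 : hi i = lo j := by apply Fin.ext; simp [hi, lo, hij]
  have si : ∀ w : Fin n → Bool, swapEntries i w (hi j) = w (hi j) := fun w =>
    swapEntries_of_ne _ _ _ (by simp [hi]; omega) (by simp [hi]; omega)
  have sj : ∀ w : Fin n → Bool, swapEntries j w (lo i) = w (lo i) := fun w =>
    swapEntries_of_ne _ _ _ (by simp [lo]; omega) (by simp [lo]; omega)
  have sil : ∀ w : Fin n → Bool, swapEntries i w (lo j) = w (lo i) := fun w => by
    rw [← e1, swapEntries_hi]
  -- alternating fillings, first relation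
  have A1 : ∀ (w : Fin n → Bool) (m : ℕ), w (lo i) ≠ w (lo j) → w (lo j) ≠ w (hi j) →
      height w i = m → m ≤ i → 0 ≤ height w (j + 2) →
      tlOp α r i (tlOp α r j (vec K r w + vec K r (swapEntries i w))) =
        (α : K) • (vec K r w + vec K r (swapEntries i w)) := by
    intro w m h1 h2 hm hmi hp
    have c0 : coef α j (swapEntries i w) = (0 : K) := by
      apply coef_same α hα
      rw [sil, si]
      revert h1 h2
      cases w (lo i) <;> cases w (lo j) <;> cases w (hi j) <;> simp
    have c1 : coef α i (swapEntries j w) = (0 : K) := by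
      apply coef_same α hα
      rw [sj, e1, swapEntries_lo]
      revert h1 h2
      cases w (lo i) <;> cases w (lo j) <;> cases w (hi j) <;> simp
    rw [map_add, tlOp_vec α hα j, tlOp_vec α hα j, c0, zero_smul, add_zero, map_smul, map_add,
      tlOp_vec α hα i, tlOp_vec α hα i, c1, zero_smul, add_zero, smul_smul, mul_comm,
      coef_mul α hα i j hij w (by rw [e1]; exact h1) h2 m hm hmi hp]
  have A2 : ∀ (w : Fin n → Bool) (m : ℕ), w (lo i) ≠ w (lo j) → w (lo j) ≠ w (hi j) →
      height w i = m → m ≤ i → 0 ≤ height w (j + 2) →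
      tlOp α r j (tlOp α r i (vec K r w + vec K r (swapEntries j w))) =
        (α : K) • (vec K r w + vec K r (swapEntries j w)) := by
    intro w m h1 h2 hm hmi hp
    have c0 : coef α j (swapEntries i w) = (0 : K) := by
      apply coef_same α hα
      rw [sil, si]
      revert h1 h2
      cases w (lo i) <;> cases w (lo j) <;> cases w (hi j) <;> simp
    have c1 : coef α i (swapEntries j w) = (0 : K) := by
      apply coef_same α hα
      rw [sj, e1, swapEntries_lo]
      revert h1 h2
      cases w (lo i) <;> cases w (lo j) <;> cases w (hi j) <;> simp
    rw [map_add, tlOp_vec α hα i, tlOp_vec α hα i, c1, zero_smul, add_zero, map_smul, map_add,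
      tlOp_vec α hα j, tlOp_vec α hα j, c0, zero_smul, add_zero, smul_smul,
      coef_mul α hα i j hij w (by rw [e1]; exact h1) h2 m hm hmi hp]
  constructor
  · refine end_ext fun w hw => ?_
    obtain ⟨m, hm, hmi⟩ := exists_height w hw i (by omega)
    have hp := height_nonneg w hw (j + 2) (by omega)
    rw [Module.End.mul_apply, Module.End.mul_apply, LinearMap.smul_apply, tlOp_vec α hα i w,
      map_smul, map_smul, smul_comm (α : K)]
    by_cases h1 : w (lo i) = w (lo j)
    · rw [coef_same α hα i w (by rw [e1]; exact h1), zero_smul, zero_smul]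
    congr 1
    by_cases h2 : w (lo j) = w (hi j)
    · have := A1 (swapEntries i w) m (by rw [swapEntries_lo, sil, e1]; exact Ne.symm h1)
        (by rw [sil, si, ← h2]; exact h1) (by rw [height_swap _ _ _ (by omega), hm]) hmi
        (by rw [height_swap _ _ _ (by omega)]; exact hp)
      rwa [swapEntries_swapEntries, add_comm (vec K r (swapEntries i w))] at this
    · exact A1 w m h1 h2 hm hmi hp
  · refine end_ext fun w hw => ?_
    obtain ⟨m, hm, hmi⟩ := exists_height w hw i (by omega)
    have hp := height_nonneg w hw (j + 2) (by omega)
    rw [Module.End.mul_apply, Module.End.mul_apply, LinearMap.smul_apply, tlOp_vec α hα j w,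
      map_smul, map_smul, smul_comm (α : K)]
    by_cases h2 : w (lo j) = w (hi j)
    · rw [coef_same α hα j w h2, zero_smul, zero_smul]
    congr 1
    by_cases h1 : w (lo i) = w (lo j)
    · have := A2 (swapEntries j w) m (by rw [swapEntries_lo, sj, h1]; exact h2)
        (by rw [swapEntries_lo, swapEntries_hi]; exact Ne.symm h2)
        (by rw [height_swap _ _ _ (by omega), hm]) hmi
        (by rw [height_swap _ _ _ (by omega)]; exact hp)
      rwa [swapEntries_swapEntries, add_comm (vec K r (swapEntries j w))] at this
    · exact A2 w m h1 h2 hm hmi hp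

lemma coef_swap (α : Kˣ) (i j : Fin (n - 1)) (hij : (i : ℕ) + 2 ≤ j ∨ (j : ℕ) + 2 ≤ i)
    (w : Fin n → Bool) : coef α i (swapEntries j w) = (coef α i w : K) := by
  unfold coef diagCoeff
  rw [content_sub, content_sub, height_swap _ _ _ (by omega),
    swapEntries_of_ne j w (lo i) (by simp [lo]; omega) (by simp [lo]; omega),
    swapEntries_of_ne j w (hi i) (by simp [hi]; omega) (by simp [hi]; omega)]

theorem tlOp_comm (α : Kˣ) (hα : n < orderOf α) (i j : Fin (n - 1)) (hij : (i : ℕ) + 2 ≤ j) :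
    tlOp (K := K) α r i * tlOp α r j = tlOp α r j * tlOp α r i := by
  refine end_ext fun w hw => ?_
  rw [Module.End.mul_apply, Module.End.mul_apply]
  simp only [tlOp_vec α hα, map_smul, map_add, coef_swap α i j (Or.inl hij),
    coef_swap α j i (Or.inr hij), swapEntries_comm i j hij, smul_add, smul_smul]
  rw [mul_comm (coef α j w)]
  abel

theorem heckeOp_braid (α : Kˣ) (hα : n < orderOf α) (i j : Fin (n - 1)) (hij : (j : ℕ) = i + 1) :
    heckeOp (K := K) α r i * heckeOp α r j * heckeOp α r i =
      heckeOp α r j * heckeOp α r i * heckeOp α r j := by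
  obtain ⟨h1, h2⟩ := tlOp_tl (r := r) α hα i j hij
  have h3 := tlOp_sq (r := r) α hα i
  have h4 := tlOp_sq (r := r) α hα j
  exact braid_of_tl (tlOp α r i) (tlOp α r j) _ _ rfl rfl h1 h2 h3 h4

theorem heckeOp_comm (α : Kˣ) (hα : n < orderOf α) (i j : Fin (n - 1)) (hij : (i : ℕ) + 2 ≤ j) :
    heckeOp (K := K) α r i * heckeOp α r j = heckeOp α r j * heckeOp α r i := by
  have h := tlOp_comm (r := r) α hα i j hij
  exact comm_of_comm (tlOp α r i) (tlOp α r j) _ _ rfl rfl h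

/-- The operator by which `σ_i` acts is invertible, by the quadratic relation. -/
theorem isUnit_heckeOp (α : Kˣ) (hα : n < orderOf α) (i : Fin (n - 1)) :
    IsUnit (heckeOp (K := K) α r i) := by
  have h := tlOp_sq (r := r) α hα i
  exact isUnit_of_sq (tlOp α r i) _ rfl α.ne_zero h

/-- The representation of the braid group `B_n` over `K` attached to the partition `[n - r, r]`, for
a parameter `α` of order larger than `n`: the representation of the (split semisimple) Hecke algebra
`H_n(α)`, i.e. `K B_n` modulo `(σ_i + 1) (σ_i - α) = 0`, in Young's seminormal form. It is
normalized so that `σ_i` acts by `-1` for the partition `[n]`. -/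
noncomputable def twoRowRep (n r : ℕ) (α : Kˣ) (hα : n < orderOf α) :
    Representation K (BraidGroup n) (StdTableau n r →₀ K) :=
  (Units.coeHom (Module.End K (StdTableau n r →₀ K))).comp <|
    PresentedGroup.toGroup (rels := braidRels n)
      (f := fun i => (isUnit_heckeOp (r := r) α hα i).unit) <| by
    rintro x ⟨i, j, ⟨hij, rfl⟩ | ⟨hij, rfl⟩⟩
    · simp only [map_mul, map_inv, FreeGroup.lift_apply_of]
      rw [mul_inv_eq_one]
      apply Units.ext
      simpa using heckeOp_braid (r := r) α hα i j hij
    · simp only [map_mul, map_inv, FreeGroup.lift_apply_of]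
      rw [mul_inv_eq_one]
      apply Units.ext
      simpa using heckeOp_comm (r := r) α hα i j hij

theorem twoRowRep_σ (α : Kˣ) (hα : n < orderOf α) (i : Fin (n - 1)) :
    twoRowRep n r α hα (BraidGroup.σ i) = heckeOp α r i := by
  simp [twoRowRep, BraidGroup.σ]

/-- `R : G → GL_N(K)` is the matrix form of the representation `ρ` in some basis. -/
def IsMatrixFormOf {G V : Type*} [Group G] [AddCommGroup V] [Module K V] {N : ℕ}
    (R : G →* Matrix.GeneralLinearGroup (Fin N) K) (ρ : Representation K G V) : Prop :=
  ∃ b : Module.Basis (Fin N) K V, ∀ g, (R g : Matrix (Fin N) (Fin N) K) = LinearMap.toMatrix b b (ρ g)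

end Rep

/-- `SL_N(K)` as a subgroup of `GL_N(K)`. -/
def SLSubgroup (N : ℕ) (K : Type*) [Field K] : Subgroup (Matrix.GeneralLinearGroup (Fin N) K) :=
  (Matrix.SpecialLinearGroup.toGL (n := Fin N) (R := K)).range

end BraidTL

/-!
# Independence of two-row representations of the braid group with large image

Let `f₁, f₂` be the restrictions of `R₁, R₂` to the commutator subgroup `Γ'` of the braid group.
For `N ≥ 3` the group `SL_N(K)` is perfect, and its proper normal subgroups are central
(`eq_top_or_le_center`), so each `f_i` maps onto `SL_{N_i}(K)`, and by Goursat's lemma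
(`surjective_prod_or_center_iff`) either `Γ'` maps onto the product, as desired, or
`f₁ g` is central exactly when `f₂ g` is central.

The second case is excluded by counting, without any knowledge of the automorphisms of
`PSL_N(K)`. In that case both special linear groups have the same central quotient, and so do
the centralizers `C_i` of the matrices `R_i(σ_0)` in them: since `R_i(σ_0)` is a non-scalar root of
`(X + 1) (X - α)`, it is not conjugate to another multiple of itself, and commuting with it can
be tested modulo the centre (`commute_iff_commutator_mem_center`). The centres have order prime to
`p`, hence the `p`-parts of `|SL_{N_i}(K)|` agree, and so do those of `|C_i|`. If `R_i(σ_0)` has the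
eigenvalue `α` with multiplicity `k_i`, these `p`-parts are `q ^ (N (N - 1) / 2)` and
`q ^ (k (k - 1) / 2 + (N - k) (N - k - 1) / 2)`.

In the seminormal basis `R_i(σ_0)` is diagonal, and `k_i` is the number of standard tableaux with
the entries `0` and `1` in the same column. The ballot formula gives
`k / N = r (n + 1 - r) / (n (n - 1))` (`tableauCount_ratio`). This is less than `1 / 2`, so the
`p`-parts determine `N` and `k`, and it is strictly increasing in `r ≤ n / 2`, so they
determine `r`.
-/

/-! ### The special linear group over a field -/

namespace Matrix.SpecialLinearGroup

open scoped commutatorElement LinearAlgebra.Projectivization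

section

variable {ι F : Type*} [DecidableEq ι] [Fintype ι]

/-- In rank at least three, every elementary transvection is a commutator of two others. -/
lemma commutator_transvection [CommRing F] {i j k : ι} (hij : i ≠ j) (hik : i ≠ k) (hkj : k ≠ j)
    (b : F) :
    ⁅transvection hik (1 : F), transvection hkj b⁆ = transvection hij b := by
  rw [commutatorElement_def, transvection_inv, transvection_inv]
  refine Subtype.ext ?_
  simp only [coe_mul, transvection_coe, mul_add, add_mul, mul_one, one_mul, ← single_neg,
    mul_neg, neg_mul, single_mul_single_same]
  simp [single_mul_single_of_ne, hij.symm, hik.symm, hkj.symm]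
  abel

variable [Field F]

/-- Whitehead's factorization of the diagonal matrix with entries `a`, `a⁻¹` into elementary
transvections. -/
lemma diag2n_eq_mul_transvection {i j : ι} (hij : i ≠ j) (a : F) (ha : a ≠ 0) :
    diag2n hij a ha = transvection hij a * transvection hij.symm (-a⁻¹) * transvection hij a *
      transvection hij (-1) * transvection hij.symm 1 * transvection hij (-1) := by
  refine Subtype.ext ?_
  simp only [coe_mul, transvection_coe, mul_add, add_mul, mul_one, one_mul, ← single_neg,
    mul_neg, neg_mul, single_mul_single_same]
  simp [single_mul_single_of_ne, hij.symm, hij, diag2n_coe, ha]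
  ext k l
  simp [Matrix.single_apply, Matrix.one_apply, diagonal_apply]
  grind

lemma transvection_induction [Nontrivial ι] (P : SpecialLinearGroup ι F → Prop)
    (htransvec : ∀ (i j : ι) (hij : i ≠ j) (a : F), P (transvection hij a))
    (hmul : ∀ A B, P A → P B → P (A * B)) (A : SpecialLinearGroup ι F) : P A := by
  refine diagonal_transvection_induction' P A (fun i j hij a ha => ?_) htransvec hmul
  rw [diag2n_eq_mul_transvection]
  refine hmul _ _ (hmul _ _ (hmul _ _ (hmul _ _ (hmul _ _ ?_ ?_) ?_) ?_) ?_) ?_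
  all_goals exact htransvec _ _ _ _

theorem isPerfect (hι : 3 ≤ Fintype.card ι) :
    Group.IsPerfect (SpecialLinearGroup ι F) := by
  have : Nontrivial ι := Fintype.one_lt_card_iff_nontrivial.mp (by omega)
  refine ⟨eq_top_iff.mpr fun A _ => transvection_induction _ (fun i j hij a => ?_)
    (fun _ _ => mul_mem) A⟩
  obtain ⟨k, hk⟩ : ∃ k, k ∉ ({i, j} : Finset ι) := by
    by_contra! h
    have := Finset.card_le_card (fun x _ => h x : Finset.univ ⊆ ({i, j} : Finset ι))
    have := Finset.card_le_two (a := i) (b := j)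
    rw [Finset.card_univ] at *
    omega
  simp only [Finset.mem_insert, Finset.mem_singleton, not_or] at hk
  rw [← commutator_transvection hij (Ne.symm hk.1) hk.2]
  exact Subgroup.commutator_mem_commutator (Subgroup.mem_top _) (Subgroup.mem_top _)

/-- The Iwasawa structure of `SL_n(F)` acting on the points of projective space: the point given by
a line `L` is assigned the abelian group of all `A` such that `A - 1` has image in `L`. -/
noncomputable def iwasawaStructure [Nontrivial ι] :
    MulAction.IwasawaStructure (SpecialLinearGroup ι F) (ℙ F (ι → F)) where
  T p := lineStab p.submodule
  is_comm p := by
    rw [← Projectivization.mk_rep p, Projectivization.submodule_mk]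
    exact lineStab_isMulCommutative_of_span p.rep p.rep_nonzero
  is_conj g p := by rw [PSL.smul_submodule, lineStab_smul]
  is_generator := by
    refine eq_top_iff.mpr fun A _ => transvection_induction _ (fun i j hij a => ?_)
      (fun _ _ => mul_mem) A
    refine Subgroup.mem_iSup_of_mem
      (.mk F (Pi.single i 1 : ι → F) (Pi.single_ne_zero_iff.2 one_ne_zero)) ?_
    rw [Projectivization.submodule_mk]
    exact SL2Gen.transvection_mem_lineStab hij a

/-- Up to its centre, `SL_n(F)` is simple for `n ≥ 3`: the Iwasawa criterion for its primitive action
on projective space, whose kernel is the centre. -/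
theorem eq_top_or_le_center (hι : 3 ≤ Fintype.card ι)
    (M : Subgroup (SpecialLinearGroup ι F)) [M.Normal] :
    M = ⊤ ∨ M ≤ Subgroup.center (SpecialLinearGroup ι F) := by
  have : Nontrivial ι := Fintype.one_lt_card_iff_nontrivial.mp (by omega)
  by_cases h : MulAction.fixedPoints M (ℙ F (ι → F)) = .univ
  · right
    intro g hg
    rw [← Projectivization.SL_mulAction_ker, MonoidHom.mem_ker]
    ext x : 1
    exact Set.eq_univ_iff_forall.mp h x ⟨g, hg⟩
  · left
    have := isPerfect (F := F) hι
    rw [eq_top_iff, ← Group.IsPerfect.commutator_eq_top]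
    exact iwasawaStructure.commutator_le M h

end

end Matrix.SpecialLinearGroup

/-! ### Pairs of quotients with the same central quotient -/

namespace BraidTL

open scoped commutatorElement

section Goursat

variable {Γ S₁ S₂ : Type*} [Group Γ] [Group S₁] [Group S₂]

lemma surjective_prod_of_map_ker_eq_top {f₁ : Γ →* S₁} {f₂ : Γ →* S₂}
    (h₂ : Function.Surjective f₂) (h : f₂.ker.map f₁ = ⊤) :
    Function.Surjective (f₁.prod f₂) := by
  rintro ⟨a, b⟩
  obtain ⟨y, rfl⟩ := h₂ b
  obtain ⟨k, hk, hka⟩ : a * (f₁ y)⁻¹ ∈ f₂.ker.map f₁ := h ▸ Subgroup.mem_top _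
  refine ⟨k * y, ?_⟩
  simp [hka, MonoidHom.mem_ker.mp hk]

/-- If `f₁ g` is central, then all commutators of `g` lie in the kernel of `f₁`, so those of `f₂ g`
are central; by Grün's lemma for the perfect group `S₂`, so is `f₂ g` itself. -/
lemma mem_center_of_map_ker_le_center [Group.IsPerfect S₂] {f₁ : Γ →* S₁} {f₂ : Γ →* S₂}
    (h₂ : Function.Surjective f₂) (h : f₁.ker.map f₂ ≤ Subgroup.center S₂) {g : Γ}
    (hg : f₁ g ∈ Subgroup.center S₁) : f₂ g ∈ Subgroup.center S₂ := by
  have h1 : (QuotientGroup.mk' (Subgroup.center S₂)) (f₂ g) ∈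
      Subgroup.center (S₂ ⧸ Subgroup.center S₂) := by
    rw [Subgroup.mem_center_iff]
    intro x
    obtain ⟨x, rfl⟩ := QuotientGroup.mk'_surjective _ x
    obtain ⟨y, rfl⟩ := h₂ x
    rw [← commutatorElement_eq_one_iff_mul_comm, ← map_commutatorElement, ← MonoidHom.mem_ker,
      QuotientGroup.ker_mk', ← map_commutatorElement]
    refine h ⟨_, ?_, rfl⟩
    rw [SetLike.mem_coe, MonoidHom.mem_ker, map_commutatorElement,
      commutatorElement_eq_one_iff_mul_comm]
    exact Subgroup.mem_center_iff.mp hg _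
  rw [Group.IsPerfect.center_quotient_center_eq_bot, Subgroup.mem_bot] at h1
  rwa [← MonoidHom.mem_ker, QuotientGroup.ker_mk'] at h1

/-- A form of Goursat's lemma for two quotients of a group `Γ` which are perfect and whose proper
normal subgroups are central: they are independent, or they have the same central quotient. -/
theorem surjective_prod_or_center_iff [Group.IsPerfect S₁] [Group.IsPerfect S₂]
    (hS₁ : ∀ M : Subgroup S₁, M.Normal → M = ⊤ ∨ M ≤ Subgroup.center S₁)
    (hS₂ : ∀ M : Subgroup S₂, M.Normal → M = ⊤ ∨ M ≤ Subgroup.center S₂)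
    {f₁ : Γ →* S₁} {f₂ : Γ →* S₂} (h₁ : Function.Surjective f₁) (h₂ : Function.Surjective f₂) :
    Function.Surjective (f₁.prod f₂) ∨
      ∀ g, f₁ g ∈ Subgroup.center S₁ ↔ f₂ g ∈ Subgroup.center S₂ := by
  rcases hS₁ _ (f₂.normal_ker.map f₁ h₁) with h | h
  · exact Or.inl (surjective_prod_of_map_ker_eq_top h₂ h)
  rcases hS₂ _ (f₁.normal_ker.map f₂ h₂) with h' | h'
  · left
    rintro ⟨a, b⟩
    obtain ⟨g, hg⟩ := surjective_prod_of_map_ker_eq_top h₁ h' (b, a)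
    exact ⟨g, Prod.ext (congrArg Prod.snd hg) (congrArg Prod.fst hg)⟩
  · exact Or.inr fun g => ⟨mem_center_of_map_ker_le_center h₂ h',
      mem_center_of_map_ker_le_center h₁ h⟩

/-- Two quotients of a group with the same central quotient: subgroups with the same preimage have
orders proportional to those of the centres. -/
lemma card_mul_card_center_eq {f₁ : Γ →* S₁} {f₂ : Γ →* S₂}
    (h₁ : Function.Surjective f₁) (h₂ : Function.Surjective f₂)
    (h : ∀ g, f₁ g ∈ Subgroup.center S₁ ↔ f₂ g ∈ Subgroup.center S₂)
    {C₁ : Subgroup S₁} {C₂ : Subgroup S₂} (hC₁ : Subgroup.center S₁ ≤ C₁)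
    (hC₂ : Subgroup.center S₂ ≤ C₂) (hC : ∀ g, f₁ g ∈ C₁ ↔ f₂ g ∈ C₂) :
    Nat.card C₁ * Nat.card (Subgroup.center S₂) = Nat.card C₂ * Nat.card (Subgroup.center S₁) := by
  have hZ : (Subgroup.center S₁).comap f₁ = (Subgroup.center S₂).comap f₂ := Subgroup.ext h
  have hC' : C₁.comap f₁ = C₂.comap f₂ := Subgroup.ext hC
  have h3 : (Subgroup.center S₁).relIndex C₁ = (Subgroup.center S₂).relIndex C₂ := by
    rw [← Subgroup.map_comap_eq_self_of_surjective h₁ C₁, ← Subgroup.relIndex_comap, hZ, hC',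
      Subgroup.relIndex_comap, Subgroup.map_comap_eq_self_of_surjective h₂]
  have h4 := Subgroup.relIndex_mul_relIndex ⊥ _ _ bot_le hC₁
  have h5 := Subgroup.relIndex_mul_relIndex ⊥ _ _ bot_le hC₂
  simp only [Subgroup.relIndex_bot_left] at h4 h5
  rw [← h4, ← h5, h3]
  ring

end Goursat

section SpecialLinear

open Matrix Matrix.SpecialLinearGroup

variable {K : Type*} [Field K] {N : ℕ}

/-- A homomorphism to `GL_N(K)` whose range contains `SL_N(K)`, the latter being perfect, restricts
to a surjection of the commutator subgroup onto `SL_N(K)`. -/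
lemma exists_commutator_surjective_specialLinearGroup {G : Type*} [Group G]
    [Group.IsPerfect (SpecialLinearGroup (Fin N) K)] (R : G →* GL (Fin N) K)
    (hR : SLSubgroup N K ≤ R.range) :
    ∃ f : commutator G →* SpecialLinearGroup (Fin N) K,
      Function.Surjective f ∧ ∀ g, toGL (f g) = R g := by
  have hdet : ∀ g ∈ commutator G, R g ∈ (toGL (n := Fin N) (R := K)).range := by
    intro g hg
    have h := Abelianization.commutator_subset_ker (GeneralLinearGroup.det.comp R) hg
    rw [MonoidHom.mem_ker, MonoidHom.comp_apply] at h
    refine ⟨⟨(R g : Matrix (Fin N) (Fin N) K), ?_⟩, ?_⟩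
    · simpa using congrArg Units.val h
    · ext i j; rfl
  let e := MonoidHom.ofInjective (toGL_injective (n := Fin N) (R := K))
  let f : commutator G →* SpecialLinearGroup (Fin N) K :=
    e.symm.toMonoidHom.comp ((R.comp (commutator G).subtype).codRestrict _ fun g => hdet g g.2)
  have hf : ∀ g, toGL (f g) = R g := by
    intro g
    exact congrArg Subtype.val (e.apply_symm_apply ⟨R g, hdet g g.2⟩)
  refine ⟨f, fun A => ?_, hf⟩
  have h : toGL A ∈ (commutator G).map R := by
    have h1 : (⊤ : Subgroup (SpecialLinearGroup (Fin N) K)).map toGL ≤ (commutator G).map R := by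
      rw [← Group.IsPerfect.commutator_eq_top, commutator_def, commutator_def,
        Subgroup.map_commutator, Subgroup.map_commutator, ← MonoidHom.range_eq_map,
        ← MonoidHom.range_eq_map]
      exact Subgroup.commutator_mono hR hR
    exact h1 ⟨A, Subgroup.mem_top _, rfl⟩
  obtain ⟨g, hg, hgA⟩ := h
  exact ⟨⟨g, hg⟩, toGL_injective ((hf _).trans hgA)⟩

/-- An invertible, non-scalar root of `(X + 1) (X - a)` is not conjugate to another multiple of
itself. -/
lemma eq_one_of_conj_eq_smul {A : Type*} [Ring A] [Algebra K A] {a l : K} (ha : a ≠ 1) {s : A}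
    (hs : (s + 1) * (s - algebraMap K A a) = 0) (hsc : ∀ b : K, s ≠ algebraMap K A b)
    (x : Aˣ) (hl : l ≠ 0) (h : (x : A) * s * (↑x⁻¹ : A) = l • s) : l = 1 := by
  have hs2 : s * s = (a - 1) • s + a • (1 : A) := by
    have h1 : (s + 1) * (s - algebraMap K A a) = s * s - ((a - 1) • s + a • (1 : A)) := by
      rw [Algebra.algebraMap_eq_smul_one]
      simp only [add_mul, mul_sub, one_mul, mul_smul_comm, mul_one, sub_smul, one_smul,
        smul_add]
      abel
    exact sub_eq_zero.mp (h1 ▸ hs)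
  have hls : (l • s) * (l • s) = (a - 1) • (l • s) + a • (1 : A) := by
    have h1 : (x : A) * s * (↑x⁻¹ : A) * ((x : A) * s * (↑x⁻¹ : A)) =
        (x : A) * (s * s) * (↑x⁻¹ : A) := by simp [mul_assoc]
    rw [← h, h1, hs2, mul_add, add_mul]
    simp
  rw [smul_mul_smul_comm, hs2] at hls
  by_contra hl1
  have hc : l * (l - 1) * (a - 1) ≠ 0 :=
    mul_ne_zero (mul_ne_zero hl (sub_ne_zero.mpr hl1)) (sub_ne_zero.mpr ha)
  have key : (l * (l - 1) * (a - 1)) • s = (a - l * l * a) • (1 : A) := by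
    have h2 : (l * (l - 1) * (a - 1)) • s - (a - l * l * a) • (1 : A) =
        (l * l) • ((a - 1) • s + a • (1 : A)) - ((a - 1) • l • s + a • (1 : A)) := by
      module
    rw [hls, sub_self] at h2
    exact sub_eq_zero.mp h2
  refine hsc ((l * (l - 1) * (a - 1))⁻¹ * (a - l * l * a)) ?_
  rw [Algebra.algebraMap_eq_smul_one, mul_smul, ← key, smul_smul, inv_mul_cancel₀ hc, one_smul]

/-- The centralizer of `R x` modulo scalars is its centralizer. Hence it can be read off from the
central quotient of `SL_N(K)` alone, although `R x` need not have determinant one. -/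
lemma commute_iff_commutator_mem_center {G : Type*} [Group G] (R : G →* GL (Fin N) K)
    (f : commutator G →* SpecialLinearGroup (Fin N) K) (hf : ∀ g, toGL (f g) = R g) (x : G) {a : K}
    (ha : a ≠ 1)
    (hx : ((R x : Matrix (Fin N) (Fin N) K) + 1) * ((R x : Matrix (Fin N) (Fin N) K) -
      algebraMap K _ a) = 0)
    (hsc : ∀ b : K, (R x : Matrix (Fin N) (Fin N) K) ≠ algebraMap K _ b) (g : commutator G) :
    Commute (R g) (R x) ↔
      f ⟨⁅(g : G), x⁆, Subgroup.commutator_mem_commutator (Subgroup.mem_top _)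
        (Subgroup.mem_top _)⟩ ∈ Subgroup.center (SpecialLinearGroup (Fin N) K) := by
  have h1 := hf ⟨⁅(g : G), x⁆, Subgroup.commutator_mem_commutator (Subgroup.mem_top _)
        (Subgroup.mem_top _)⟩
  rw [map_commutatorElement] at h1
  constructor
  · intro h
    rw [commutatorElement_eq_one_iff_commute.mpr h] at h1
    rw [toGL_injective (h1.trans (map_one _).symm)]
    exact one_mem _
  · intro h
    obtain ⟨l, -, hl⟩ := mem_center_iff.mp h
    have h2 : ((⁅R g, R x⁆ : GL (Fin N) K) : Matrix (Fin N) (Fin N) K) = algebraMap K _ l := by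
      rw [← h1, coe_GL_coe_matrix, ← hl]
      rfl
    have hN : Nontrivial (Matrix (Fin N) (Fin N) K) := by
      by_contra hN
      rw [not_nontrivial_iff_subsingleton] at hN
      exact hsc 0 (Subsingleton.elim _ _)
    have hl0 : l ≠ 0 := by
      rintro rfl
      rw [map_zero] at h2
      exact (⁅R g, R x⁆ : GL (Fin N) K).ne_zero h2
    have h3 : R g * R x * (R g)⁻¹ = ⁅R g, R x⁆ * R x := by
      rw [commutatorElement_def, inv_mul_cancel_right]
    have h4 := congrArg Units.val h3
    rw [Units.val_mul, Units.val_mul, Units.val_mul, h2, ← Algebra.smul_def] at h4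
    have h5 := eq_one_of_conj_eq_smul ha hx hsc (R g) hl0 h4
    rw [h5, map_one] at h2
    exact commutatorElement_eq_one_iff_commute.mp (Units.ext h2)

end SpecialLinear

end BraidTL

/-! ### Orders of centralizers over a finite field -/

namespace BraidTL
open Matrix Matrix.SpecialLinearGroup

section Valuation

variable {p : ℕ} [Fact p.Prime] {K : Type*} [Field K] [Finite K]

lemma padicValNat_prod_eq_sum {ι : Type*} (s : Finset ι) (g : ι → ℕ) (hg : ∀ i ∈ s, g i ≠ 0) :
    padicValNat p (∏ i ∈ s, g i) = ∑ i ∈ s, padicValNat p (g i) := by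
  classical
  induction s using Finset.induction_on with
  | empty => simp
  | insert a s ha ih =>
    rw [Finset.prod_insert ha, Finset.sum_insert ha,
      padicValNat.mul (hg _ (Finset.mem_insert_self _ _))
        (Finset.prod_ne_zero_iff.mpr fun i hi => hg i (Finset.mem_insert_of_mem hi)),
      ih fun i hi => hg i (Finset.mem_insert_of_mem hi)]

variable (p) in
/-- The `p`-part of `|GL_N(q)|` is `q ^ (N (N - 1) / 2)`; the factor `2` avoids the division. -/
lemma two_mul_padicValNat_card_GL {f : ℕ} (hK : Nat.card K = p ^ f) {ι : Type*} [Fintype ι]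
    [DecidableEq ι] :
    2 * padicValNat p (Nat.card (GL ι K)) = f * (Fintype.card ι * (Fintype.card ι - 1)) := by
  have := Fintype.ofFinite K
  have e : GL ι K ≃* GL (Fin (Fintype.card ι)) K :=
    Units.mapEquiv (Matrix.reindexAlgEquiv K K (Fintype.equivFin ι)).toMulEquiv
  have hq : 1 < Nat.card K := Finite.one_lt_card
  have hp : p.Prime := Fact.out
  have hf : f ≠ 0 := by rintro rfl; rw [hK, pow_zero] at hq; exact lt_irrefl _ hq
  rw [Nat.card_congr e.toEquiv, Matrix.card_GL_field,
    ← Nat.card_eq_fintype_card (α := K)]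
  generalize Fintype.card ι = N
  -- `q ^ N - q ^ i = q ^ i (q ^ (N - i) - 1)`, and `p` does not divide the second factor.
  have hterm : ∀ i : Fin N, Nat.card K ^ N - Nat.card K ^ (i : ℕ) ≠ 0 ∧
      padicValNat p (Nat.card K ^ N - Nat.card K ^ (i : ℕ)) = f * i := by
    intro i
    obtain ⟨d, hd⟩ : ∃ d, N = i + (d + 1) := ⟨N - i - 1, by omega⟩
    have h1 : Nat.card K ^ N - Nat.card K ^ (i : ℕ) =
        p ^ (f * i) * (Nat.card K ^ (d + 1) - 1) := by
      rw [Nat.mul_sub, mul_one, pow_mul, ← hK, ← pow_add, ← hd]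
    have h2 : 1 < Nat.card K ^ (d + 1) := Nat.one_lt_pow (by omega) hq
    have h3 : ¬ p ∣ Nat.card K ^ (d + 1) - 1 := by
      intro h
      have h4 : p ∣ Nat.card K ^ (d + 1) := by
        rw [hK, ← pow_mul]
        exact dvd_pow_self p (by positivity)
      have := (Nat.dvd_sub h4 h)
      rw [Nat.sub_sub_self h2.le] at this
      exact hp.one_lt.ne' (Nat.dvd_one.mp this)
    refine ⟨?_, ?_⟩
    · rw [h1]
      exact mul_ne_zero (pow_ne_zero _ hp.ne_zero) (by omega)
    · rw [h1, padicValNat.mul (pow_ne_zero _ hp.ne_zero) (by omega), padicValNat.prime_pow,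
        padicValNat.eq_zero_of_not_dvd h3, add_zero]
  rw [padicValNat_prod_eq_sum _ _ fun i _ => (hterm i).1, Finset.sum_congr rfl fun i _ =>
    (hterm i).2, ← Finset.mul_sum, Fin.sum_univ_eq_sum_range (fun i => i),
    mul_left_comm, mul_comm 2, Finset.sum_range_id_mul_two]

variable [Algebra (ZMod p) K]

variable (p K) in
lemma exists_card_eq_prime_pow : ∃ f, 0 < f ∧ Nat.card K = p ^ f := by
  have : CharP K p := charP_of_injective_algebraMap (algebraMap (ZMod p) K).injective p
  have := Fintype.ofFinite K
  obtain ⟨f, -, hf⟩ := FiniteField.card K p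
  exact ⟨f, f.pos, by rw [Nat.card_eq_fintype_card, hf]⟩

variable (p K) in
lemma not_dvd_card_units : ¬ p ∣ Nat.card Kˣ := by
  obtain ⟨f, hf, hK⟩ := exists_card_eq_prime_pow p K
  have h := Nat.card_eq_card_units_add_one K
  intro hd
  have h1 : p ∣ Nat.card Kˣ + 1 := by rw [← h, hK]; exact dvd_pow_self p hf.ne'
  exact (Fact.out : p.Prime).one_lt.ne' (Nat.dvd_one.mp ((Nat.dvd_add_right hd).mp h1))

variable (p) in
lemma padicValNat_card_eq_zero {G : Type*} [Group G] [Finite G] (φ : G →* Kˣ)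
    (hφ : Function.Injective φ) : padicValNat p (Nat.card G) = 0 :=
  padicValNat.eq_zero_of_not_dvd fun h =>
    not_dvd_card_units p K (h.trans (Subgroup.card_dvd_of_injective φ hφ))

variable (p) in
/-- Intersecting a subgroup of `GL_N(K)` with `SL_N(K)` does not change the `p`-part of its order,
since the determinants form a group of order prime to `p`. -/
lemma padicValNat_card_comap_toGL {N : ℕ} (H : Subgroup (GL (Fin N) K)) :
    padicValNat p (Nat.card (H.comap toGL : Subgroup (SpecialLinearGroup (Fin N) K))) =
      padicValNat p (Nat.card H) := by
  let d : H →* Kˣ := GeneralLinearGroup.det.comp H.subtype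
  have hdet (A : d.ker) : (A.1.1 : Matrix (Fin N) (Fin N) K).det = 1 :=
    congrArg Units.val (MonoidHom.mem_ker.mp A.2)
  have e : (H.comap toGL : Subgroup (SpecialLinearGroup (Fin N) K)) ≃ d.ker :=
    { toFun := fun A => ⟨⟨toGL A.1, A.2⟩, Units.ext A.1.2⟩
      invFun := fun A => ⟨⟨A.1.1, hdet A⟩, by
        have h : toGL ⟨A.1.1, hdet A⟩ = A.1.1 := Units.ext rfl
        exact Subgroup.mem_comap.mpr (h.symm ▸ A.1.2)⟩
      left_inv := fun A => rfl
      right_inv := fun A => Subtype.ext (Subtype.ext (Units.ext rfl)) }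
  rw [Nat.card_congr e, ← Subgroup.card_mul_index d.ker, padicValNat.mul Nat.card_pos.ne'
    (Subgroup.index_ne_zero_of_finite), Subgroup.index_ker,
    padicValNat_card_eq_zero p d.range.subtype Subtype.val_injective, add_zero]

variable (p K) in
lemma padicValNat_card_center (N : ℕ) :
    padicValNat p (Nat.card (Subgroup.center (SpecialLinearGroup (Fin N) K))) = 0 :=
  padicValNat_card_eq_zero p ((Subgroup.subtype _).comp
    (center_equiv_rootsOfUnity (n := Fin N) (R := K)).toMonoidHom)
    (Subtype.val_injective.comp (MulEquiv.injective _))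

end Valuation

section Centralizer

variable {K : Type*} [Field K] {m n : Type*} [Fintype m] [Fintype n] [DecidableEq m] [DecidableEq n]

/-- The embedding of `GL_m × GL_n` into `GL_{m + n}` by block diagonal matrices. -/
def blockDiag : GL m K × GL n K →* GL (m ⊕ n) K :=
  (Units.map
    { toFun := fun X : Matrix m m K × Matrix n n K => Matrix.fromBlocks X.1 0 0 X.2
      map_one' := Matrix.fromBlocks_one
      map_mul' := fun X Y => by simp [Matrix.fromBlocks_multiply] }).comp
  (MulEquiv.prodUnits (M := Matrix m m K) (N := Matrix n n K)).symm.toMonoidHom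

lemma coe_blockDiag (X : GL m K × GL n K) :
    (blockDiag X : Matrix (m ⊕ n) (m ⊕ n) K) = Matrix.fromBlocks X.1.1 0 0 X.2.1 := rfl

lemma blockDiag_injective : Function.Injective (blockDiag (K := K) (m := m) (n := n)) := by
  intro X Y h
  have h1 := congrArg Units.val h
  rw [coe_blockDiag, coe_blockDiag, Matrix.fromBlocks_inj] at h1
  exact Prod.ext (Units.ext h1.1) (Units.ext h1.2.2.2)

/-- The centralizer of a diagonal matrix with two distinct eigenvalues consists of the block
diagonal matrices. -/
lemma centralizer_eq_range_blockDiag {a b : K} (hab : a ≠ b) (s : GL (m ⊕ n) K)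
    (hs : (s : Matrix (m ⊕ n) (m ⊕ n) K) = Matrix.fromBlocks (a • 1) 0 0 (b • 1)) :
    Subgroup.centralizer {s} = (blockDiag (K := K) (m := m) (n := n)).range := by
  ext X
  rw [Subgroup.mem_centralizer_singleton_iff, MonoidHom.mem_range]
  constructor
  · intro h
    have h1 := congrArg Units.val h
    rw [Units.val_mul, Units.val_mul, hs, ← Matrix.fromBlocks_toBlocks X.1,
      Matrix.fromBlocks_multiply, Matrix.fromBlocks_multiply, Matrix.fromBlocks_inj] at h1
    simp only [Matrix.mul_zero, Matrix.zero_mul, add_zero, zero_add, Matrix.smul_mul,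
      Matrix.mul_smul, Matrix.one_mul, Matrix.mul_one, true_and, and_true] at h1
    have hab' := sub_ne_zero.mpr hab
    have h12 : X.1.toBlocks₁₂ = 0 := by
      have : (a - b) • X.1.toBlocks₁₂ = 0 := by rw [sub_smul, h1.1, sub_self]
      exact (smul_eq_zero.mp this).resolve_left hab'
    have h21 : X.1.toBlocks₂₁ = 0 := by
      have : (a - b) • X.1.toBlocks₂₁ = 0 := by rw [sub_smul, ← h1.2, sub_self]
      exact (smul_eq_zero.mp this).resolve_left hab'
    have hX : X.1 = Matrix.fromBlocks X.1.toBlocks₁₁ 0 0 X.1.toBlocks₂₂ := by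
      rw [← h12, ← h21, Matrix.fromBlocks_toBlocks]
    have hdet : IsUnit (X.1.toBlocks₁₁.det * X.1.toBlocks₂₂.det) := by
      rw [← Matrix.det_fromBlocks_zero₂₁ _ 0, ← hX]
      exact (Matrix.isUnit_iff_isUnit_det _).mp X.isUnit
    rw [IsUnit.mul_iff] at hdet
    refine ⟨(GeneralLinearGroup.mk'' _ hdet.1, GeneralLinearGroup.mk'' _ hdet.2), Units.ext ?_⟩
    rw [coe_blockDiag]
    exact hX.symm
  · rintro ⟨X, rfl⟩
    refine Units.ext ?_
    rw [Units.val_mul, Units.val_mul, hs, coe_blockDiag, Matrix.fromBlocks_multiply,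
      Matrix.fromBlocks_multiply]
    simp

lemma card_centralizer_fromBlocks {a b : K} (hab : a ≠ b) (s : GL (m ⊕ n) K)
    (hs : (s : Matrix (m ⊕ n) (m ⊕ n) K) = Matrix.fromBlocks (a • 1) 0 0 (b • 1)) :
    Nat.card (Subgroup.centralizer {s}) = Nat.card (GL m K) * Nat.card (GL n K) := by
  rw [centralizer_eq_range_blockDiag hab s hs, ← Nat.card_prod]
  exact (Nat.card_congr (MonoidHom.ofInjective blockDiag_injective).toEquiv).symm

lemma card_centralizer_map {G H : Type*} [Group G] [Group H] (e : G ≃* H) (s : G) :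
    Nat.card (Subgroup.centralizer {e s}) = Nat.card (Subgroup.centralizer {s}) := by
  refine (Nat.card_congr (e.toEquiv.subtypeEquiv fun g => ?_)).symm
  simp [Subgroup.mem_centralizer_singleton_iff, ← map_mul]

end Centralizer

end BraidTL

/-! ### Counting two-row standard tableaux -/

namespace BraidTL

section Count

lemma rowCount_snoc {n : ℕ} (w : Fin n → Bool) (x b : Bool) (k : ℕ) :
    rowCount (Fin.snoc (α := fun _ => Bool) w x) b k =
      rowCount w b k + if n < k ∧ x = b then 1 else 0 := by
  unfold rowCount
  rw [Finset.card_filter, Finset.card_filter, Fin.sum_univ_castSucc]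
  simp [-Finset.sum_boole]

lemma rowCount_of_le {n : ℕ} (w : Fin n → Bool) (b : Bool) {k : ℕ} (hk : n ≤ k) :
    rowCount w b k = rowCount w b n := by
  refine congrArg Finset.card (Finset.ext fun j => ?_)
  simp only [Finset.mem_filter, Finset.mem_univ, true_and, j.2, j.2.trans_le hk]

/-- A filling is standard iff it is so without its largest entry and its second row is not longer
than its first. -/
lemma isStandard_snoc {n r : ℕ} (w : Fin n → Bool) (x : Bool) :
    IsStandard r (Fin.snoc (α := fun _ => Bool) w x) ↔
      rowCount w true n + (if x then 1 else 0) = r ∧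
      (∀ k ≤ n, rowCount w true k ≤ rowCount w false k) ∧ 2 * r ≤ n + 1 := by
  have h1 := rowCount_add w n le_rfl
  have hk : ∀ k ≤ n, ∀ b, rowCount (Fin.snoc (α := fun _ => Bool) w x) b k = rowCount w b k := by
    intro k hk b
    rw [rowCount_snoc, if_neg (by omega), add_zero]
  have hn : ∀ b, rowCount (Fin.snoc (α := fun _ => Bool) w x) b (n + 1) =
      rowCount w b n + if x = b then 1 else 0 := by
    intro b
    rw [rowCount_snoc, rowCount_of_le w b (Nat.le_succ n)]
    simp
  have hall : (∀ k ≤ n + 1, rowCount (Fin.snoc (α := fun _ => Bool) w x) true k ≤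
      rowCount (Fin.snoc (α := fun _ => Bool) w x) false k) ↔
      (∀ k ≤ n, rowCount w true k ≤ rowCount w false k) ∧
      rowCount w true n + (if x = true then 1 else 0) ≤
        rowCount w false n + if x = false then 1 else 0 := by
    rw [← hn, ← hn]
    refine ⟨fun h => ⟨fun k hkn => ?_, h _ le_rfl⟩, fun h k hkn => ?_⟩
    · rw [← hk k hkn, ← hk k hkn]
      exact h k (by omega)
    · rcases Nat.le_succ_iff.mp hkn with h' | h'
      · rw [hk k h', hk k h']
        exact h.1 k h'
      · rw [h']
        exact h.2
  rw [IsStandard, hn, hall]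
  cases x <;> simp <;> grind

/-- The number of standard tableaux of shape `[n - r, r]` which have `j` of the `m` smallest entries
in the second row. -/
def tableauCount (m j n r : ℕ) : ℕ :=
  (Finset.univ.filter fun w : Fin n → Bool => IsStandard r w ∧ rowCount w true m = j).card

lemma two_mul_le_of_isStandard {n r : ℕ} {w : Fin n → Bool} (hw : IsStandard r w) : 2 * r ≤ n := by
  have h1 := rowCount_add w n le_rfl
  have h2 := hw.2 n le_rfl
  have h3 := hw.1
  omega

lemma tableauCount_eq_zero {m j n r : ℕ} (h : n < 2 * r) : tableauCount m j n r = 0 := by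
  refine Finset.card_eq_zero.mpr (Finset.filter_eq_empty_iff.mpr fun w _ hw => ?_)
  have := two_mul_le_of_isStandard hw.1
  omega

lemma tableauCount_add_one {m n : ℕ} (hm : m ≤ n) (j r : ℕ) :
    tableauCount m j (n + 1) r =
      (Finset.univ.filter fun w : Fin n → Bool =>
        IsStandard r (Fin.snoc (α := fun _ => Bool) w false) ∧ rowCount w true m = j).card +
      (Finset.univ.filter fun w : Fin n → Bool =>
        IsStandard r (Fin.snoc (α := fun _ => Bool) w true) ∧ rowCount w true m = j).card := by
  unfold tableauCount
  simp only [Finset.card_filter]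
  rw [← (Fin.snocEquiv fun _ => Bool).sum_comp, Fintype.sum_prod_type, Fintype.sum_bool, add_comm]
  simp [Fin.snocEquiv, rowCount_snoc, Nat.not_lt.mpr hm]

lemma tableauCount_succ_succ {m n : ℕ} (hm : m ≤ n) (j : ℕ) {r : ℕ} (hr : 2 * (r + 1) ≤ n + 1) :
    tableauCount m j (n + 1) (r + 1) = tableauCount m j n (r + 1) + tableauCount m j n r := by
  rw [tableauCount_add_one hm]
  unfold tableauCount
  congr 2 <;>
  · ext w
    simp only [Finset.mem_filter, Finset.mem_univ, true_and, isStandard_snoc]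
    refine and_congr_left fun _ => ?_
    simp [IsStandard]
    grind

lemma tableauCount_succ_zero {m n : ℕ} (hm : m ≤ n) (j : ℕ) :
    tableauCount m j (n + 1) 0 = tableauCount m j n 0 := by
  rw [tableauCount_add_one hm]
  unfold tableauCount
  have : (Finset.univ.filter fun w : Fin n → Bool =>
        IsStandard 0 (Fin.snoc (α := fun _ => Bool) w true) ∧ rowCount w true m = j) = ∅ := by
    refine Finset.filter_eq_empty_iff.mpr fun w _ hw => ?_
    rw [isStandard_snoc] at hw
    simp at hw
  rw [this, Finset.card_empty, add_zero]
  congr 1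
  ext w
  simp only [Finset.mem_filter, Finset.mem_univ, true_and, isStandard_snoc]
  refine and_congr_left fun _ => ?_
  simp [IsStandard]

open Nat in
/-- The solution of the ballot recursion: `F n r = n! (n + 1 - 2 r) / (r! (n + 1 - r)!)`, where
`d = n + 1 - 2 r`. -/
lemma ballot_formula {F : ℕ → ℕ → ℕ} (h00 : F 0 0 = 1) (hn0 : ∀ n, F (n + 1) 0 = F n 0)
    (hrec : ∀ n r, 2 * (r + 1) ≤ n + 1 → F (n + 1) (r + 1) = F n (r + 1) + F n r)
    (hz : ∀ n r, n < 2 * r → F n r = 0) (n : ℕ) :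
    ∀ r d, n + 1 = 2 * r + d → F n r * (r ! * (r + d)!) = n ! * d := by
  induction n with
  | zero =>
    intro r d h
    obtain ⟨rfl, rfl⟩ : r = 0 ∧ d = 1 := by omega
    simp [h00]
  | succ n ih =>
    intro r d h
    cases r with
    | zero =>
      have h1 := ih 0 (n + 1) (by omega)
      obtain rfl : d = n + 2 := by omega
      simp only [zero_add, factorial_zero, one_mul] at h1 ⊢
      rw [hn0, factorial_succ (n + 1), mul_left_comm, h1, factorial_succ]
      ring
    | succ r =>
      cases d with
      | zero => rw [hz _ _ (by omega)]; simp
      | succ d =>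
        have h1 := ih (r + 1) d (by omega)
        have h2 := ih r (d + 2) (by omega)
        rw [hrec n r (by omega)]
        rw [show r + (d + 2) = (r + d + 1) + 1 by ring] at h2
        rw [show r + 1 + d = r + d + 1 by ring] at h1
        rw [show r + 1 + (d + 1) = (r + d + 1) + 1 by ring]
        rw [factorial_succ (r + d + 1)] at h2 ⊢
        rw [factorial_succ r] at h1 ⊢
        obtain rfl : n = 2 * r + d + 1 := by omega
        rw [factorial_succ (2 * r + d + 1)]
        linear_combination (r + d + 2) * h1 + (r + 1) * h2

lemma tableauCount_zero_formula {n r d : ℕ} (h : n + 1 = 2 * r + d) :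
    tableauCount 0 0 n r * (r.factorial * (r + d).factorial) = n.factorial * d :=
  ballot_formula (F := tableauCount 0 0) (by decide) (fun n => tableauCount_succ_zero (zero_le) 0)
    (fun n r hr => tableauCount_succ_succ zero_le 0 hr) (fun n r hr => tableauCount_eq_zero hr)
    n r d h

/-- Tableaux of shape `[n + 1 - r, r + 1]` with `0` and `1` in the same column are as numerous as
all tableaux of shape `[n - r, r]`. -/
lemma tableauCount_two_formula {n r d : ℕ} (h : n + 1 = 2 * r + d) :
    tableauCount 2 1 (n + 2) (r + 1) * (r.factorial * (r + d).factorial) = n.factorial * d := by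
  have h0 : ∀ n, tableauCount 2 1 (n + 2) 0 = 0 := by
    intro n
    induction n with
    | zero => decide
    | succ n ih => exact (tableauCount_succ_zero (n := n + 2) (by omega) 1).trans ih
  refine ballot_formula (F := fun n r => tableauCount 2 1 (n + 2) (r + 1)) (by decide)
    (fun n => ?_) (fun n r hr => ?_) (fun n r hr => tableauCount_eq_zero (by omega)) n r d h
  · change tableauCount 2 1 (n + 2 + 1) (0 + 1) = _
    rw [tableauCount_succ_succ (by omega) 1 (by omega), h0, add_zero]
  · exact tableauCount_succ_succ (by omega) 1 (by omega)

lemma c_eq_tableauCount (n r : ℕ) : c n r = tableauCount 0 0 n r := by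
  rw [c, Fintype.card_subtype]
  simp [tableauCount, rowCount]

/-- Among the standard tableaux of shape `[n - r, r]`, the proportion of those with `0, 1` in the
same column is `r (n + 1 - r) / (n (n - 1))`; here `n = m + 2` and `r = s + 1`. -/
lemma tableauCount_ratio {m s : ℕ} (h : 2 * s ≤ m) :
    (m + 2) * (m + 1) * tableauCount 2 1 (m + 2) (s + 1) =
      (s + 1) * (m + 2 - s) * c (m + 2) (s + 1) := by
  obtain ⟨d, hd⟩ : ∃ d, m = 2 * s + d := ⟨m - 2 * s, by omega⟩
  have h1 := tableauCount_two_formula (n := m) (r := s) (d := d + 1) (by omega)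
  have h2 := tableauCount_zero_formula (n := m + 2) (r := s + 1) (d := d + 1) (by omega)
  rw [c_eq_tableauCount]
  rw [show s + 1 + (d + 1) = (s + (d + 1)) + 1 by ring, Nat.factorial_succ s,
    Nat.factorial_succ (s + (d + 1)), Nat.factorial_succ (m + 1), Nat.factorial_succ m] at h2
  rw [show m + 2 - s = s + (d + 1) + 1 by omega]
  have hpos : 0 < s.factorial * (s + (d + 1)).factorial := by positivity
  refine Nat.eq_of_mul_eq_mul_right hpos ?_
  linear_combination (m + 2) * (m + 1) * h1 - h2

lemma tableauCount_two_pos {m s : ℕ} (h : 2 * s ≤ m) :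
    0 < tableauCount 2 1 (m + 2) (s + 1) := by
  obtain ⟨d, hd⟩ : ∃ d, m = 2 * s + d := ⟨m - 2 * s, by omega⟩
  have h1 := tableauCount_two_formula (n := m) (r := s) (d := d + 1) (by omega)
  rcases Nat.eq_zero_or_pos (tableauCount 2 1 (m + 2) (s + 1)) with h0 | h0
  · rw [h0, zero_mul] at h1
    have : 0 < m.factorial * (d + 1) := by positivity
    omega
  · exact h0

/-- Fewer than half of the standard tableaux have `0, 1` in the same column, because
`2 r (n + 1 - r) < n (n - 1)` for `2 r ≤ n` and `n ≥ 5`. -/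
lemma two_mul_tableauCount_lt {m s : ℕ} (hm : 3 ≤ m) (h : 2 * s ≤ m) :
    2 * tableauCount 2 1 (m + 2) (s + 1) < c (m + 2) (s + 1) := by
  have h1 := tableauCount_ratio h
  have h2 := tableauCount_two_pos h
  obtain ⟨d, hd⟩ : ∃ d, m = 2 * s + d := ⟨m - 2 * s, by omega⟩
  rw [show m + 2 - s = s + d + 2 by omega] at h1
  by_contra! h3
  have h4 : 2 * ((s + 1) * (s + d + 2)) < (m + 2) * (m + 1) := by
    subst hd
    nlinarith
  have h5 := Nat.mul_le_mul_left ((s + 1) * (s + d + 2)) h3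
  have h6 := Nat.mul_lt_mul_of_pos_right h4 h2
  rw [h1] at h6
  linarith

/-- The shape `[n - r, r]`, `r ≥ 1`, is determined by its number of standard tableaux together with
the number of those which have `0, 1` in the same column. -/
lemma eq_of_c_eq {m s t : ℕ} (hs : 2 * s ≤ m) (ht : 2 * t ≤ m)
    (hc : c (m + 2) (s + 1) = c (m + 2) (t + 1))
    (hk : tableauCount 2 1 (m + 2) (s + 1) = tableauCount 2 1 (m + 2) (t + 1)) : s = t := by
  have h1 := tableauCount_ratio hs
  have h2 := tableauCount_ratio ht
  have h3 := tableauCount_two_pos hs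
  have hpos : 0 < c (m + 2) (s + 1) := by
    rcases Nat.eq_zero_or_pos (c (m + 2) (s + 1)) with h0 | h0
    · rw [h0, mul_zero] at h1
      have : 0 < (m + 2) * (m + 1) * tableauCount 2 1 (m + 2) (s + 1) := by positivity
      omega
    · exact h0
  rw [← hk, h1, hc] at h2
  have h4 := Nat.eq_of_mul_eq_mul_right (hc ▸ hpos) h2
  zify [show s ≤ m + 2 by omega, show t ≤ m + 2 by omega] at h4
  have h5 : ((s : ℤ) - t) * (m + 1 - s - t) = 0 := by linear_combination h4
  rcases mul_eq_zero.mp h5 with h6 | h6 <;> omega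

end Count

end BraidTL

/-! ### The first generator of the braid group -/

namespace BraidTL
open Matrix Matrix.SpecialLinearGroup

section FirstGenerator

variable {K : Type*} [Field K]

lemma ne_one_of_lt_orderOf {n : ℕ} (hn : 2 ≤ n) {α : Kˣ} (hα : n < orderOf α) :
    (α : K) ≠ 1 ∧ (α : K) ≠ -1 := by
  have h : (α : K) ^ 2 ≠ 1 := by
    have := zpow_ne_one α hα 2 (by norm_num) (by omega)
    exact_mod_cast this
  constructor
  · intro h'; rw [h'] at h; simp at h
  · intro h'; rw [h'] at h; simp at h

lemma apply_zero_of_isStandard {n r : ℕ} {w : Fin n → Bool} (hw : IsStandard r w) (h : 0 < n) :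
    w ⟨0, h⟩ = false := by
  have h1 := hw.2 1 h
  have h2 := fun b => rowCount_succ w b ⟨0, h⟩
  simp only [zero_add] at h2
  rw [h2, h2] at h1
  cases hw0 : w ⟨0, h⟩
  · rfl
  · simp [hw0, rowCount] at h1

/-- For a standard tableau, `1` lies in the second row iff that row has exactly one of the
entries `0`, `1`. -/
lemma rowCount_two_eq_one_iff {n r : ℕ} {w : Fin n → Bool} (hw : IsStandard r w) (h : 1 < n) :
    rowCount w true 2 = 1 ↔ w ⟨1, h⟩ = true := by
  have h1 := rowCount_succ w true ⟨0, by omega⟩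
  have h2 := rowCount_succ w true ⟨1, h⟩
  rw [apply_zero_of_isStandard hw] at h1
  simp only [zero_add, one_add_one_eq_two] at h1 h2
  rw [h2, h1]
  simp [rowCount]

/-- The first generator is diagonal in the seminormal basis: `0` and `1` are always in the same row
or in the same column. -/
lemma heckeOp_zero_vec {n r : ℕ} (h : 1 < n) (α : Kˣ) (hα : n < orderOf α) {w : Fin n → Bool}
    (hw : IsStandard r w) :
    heckeOp α r ⟨0, by omega⟩ (vec K r w) =
      (if w ⟨1, h⟩ = true then (α : K) else -1) • vec K r w := by
  have h0 := apply_zero_of_isStandard hw (by omega)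
  have h1 := tlOp_vec (r := r) α hα ⟨0, by omega⟩ w
  rw [tlOp, LinearMap.add_apply, Module.End.one_apply, ← eq_sub_iff_add_eq] at h1
  rw [h1]
  split_ifs with hw1
  · have hα1 := sub_ne_zero.mpr (ne_one_of_lt_orderOf h hα).1
    have hs : ¬ IsStandard r (swapEntries ⟨0, by omega⟩ w) := by
      intro hs
      have h2 := apply_zero_of_isStandard hs (by omega)
      have h3 := swapEntries_lo ⟨0, by omega⟩ w
      exact absurd (h2.symm.trans (h3.trans hw1)) (by simp)
    rw [coef_ft α hα ⟨0, by omega⟩ w 0 (by simp [height, rowCount]) (by omega) h0 hw1, vec, vec, dif_neg hs,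
      add_zero, zero_add, zero_add, pow_one,
      show ((α : K) ^ 2 - 1) / ((α : K) - 1) = α + 1 by field_simp; ring]
    module
  · rw [coef_same α hα ⟨0, by omega⟩ w (by rw [Bool.not_eq_true] at hw1; exact h0.trans hw1.symm)]
    module

/-- The standard tableaux with the entry `1` in the second row (`b = true`), respectively in the
first row (`b = false`). -/
abbrev TableauWith (n r : ℕ) (h : 1 < n) (b : Bool) : Type :=
  {w : StdTableau n r // w.1 ⟨1, h⟩ = b}

/-- The standard tableaux, split according to the row of the entry `1`. -/
def tableauSplit (n r : ℕ) (h : 1 < n) :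
    TableauWith n r h true ⊕ TableauWith n r h false ≃ StdTableau n r :=
  (Equiv.sumCongr (Equiv.refl _) (Equiv.subtypeEquivRight fun w => by simp)).trans
    (Equiv.sumCompl fun w : StdTableau n r => w.1 ⟨1, h⟩ = true)

lemma card_tableauWith_true (n r : ℕ) (h : 1 < n) :
    Fintype.card (TableauWith n r h true) = tableauCount 2 1 n r := by
  rw [tableauCount, ← Fintype.card_subtype]
  refine Fintype.card_congr ((Equiv.subtypeSubtypeEquivSubtypeExists _ _).trans
    (Equiv.subtypeEquivRight fun w => ?_))
  exact exists_prop.trans (and_congr_right fun hw => (rowCount_two_eq_one_iff hw h).symm)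

lemma card_tableauWith_add (n r : ℕ) (h : 1 < n) :
    Fintype.card (TableauWith n r h true) + Fintype.card (TableauWith n r h false) = c n r := by
  rw [← Fintype.card_sum, c]
  exact Fintype.card_congr (tableauSplit n r h)

/-- The seminormal basis, split according to the row of the entry `1`. -/
noncomputable def splitBasis (K : Type*) [Field K] (n r : ℕ) (h : 1 < n) :
    Module.Basis (TableauWith n r h true ⊕ TableauWith n r h false) K (StdTableau n r →₀ K) :=
  Finsupp.basisSingleOne.reindex (tableauSplit n r h).symm

lemma splitBasis_apply {n r : ℕ} (h : 1 < n) (x : TableauWith n r h true ⊕ TableauWith n r h false) :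
    splitBasis K n r h x = vec K r (tableauSplit n r h x).1 := by
  simp [splitBasis, vec, (tableauSplit n r h x).2]

lemma heckeOp_zero_splitBasis {n r : ℕ} (h : 1 < n) (α : Kˣ) (hα : n < orderOf α)
    (x : TableauWith n r h true ⊕ TableauWith n r h false) :
    heckeOp α r ⟨0, by omega⟩ (splitBasis K n r h x) =
      (Sum.elim (fun _ => (α : K)) (fun _ => -1) x) • splitBasis K n r h x := by
  rw [splitBasis_apply, heckeOp_zero_vec h α hα (tableauSplit n r h x).2]
  rcases x with x | x
  · simp [tableauSplit, x.2]
  · simp [tableauSplit, x.2]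

lemma toMatrix_heckeOp_zero {n r : ℕ} (h : 1 < n) (α : Kˣ) (hα : n < orderOf α) :
    LinearMap.toMatrix (splitBasis K n r h) (splitBasis K n r h) (heckeOp α r ⟨0, by omega⟩) =
      fromBlocks ((α : K) • 1) 0 0 ((-1 : K) • 1) := by
  ext x y
  rw [LinearMap.toMatrix_apply, heckeOp_zero_splitBasis h α hα, map_smul, Module.Basis.repr_self]
  rcases x with x | x <;> rcases y with y | y <;>
    simp [Finsupp.single_apply, Matrix.one_apply, eq_comm]

lemma heckeOp_zero_ne_algebraMap {n r : ℕ} (h : 1 < n) (α : Kˣ) (hα : n < orderOf α)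
    (ht : Nonempty (TableauWith n r h true)) (hf : Nonempty (TableauWith n r h false)) (b : K) :
    heckeOp (n := n) α r ⟨0, by omega⟩ ≠ algebraMap K _ b := by
  intro hb
  have key : ∀ x : TableauWith n r h true ⊕ TableauWith n r h false,
      Sum.elim (fun _ => (α : K)) (fun _ => -1) x = b := by
    intro x
    have h1 := heckeOp_zero_splitBasis h α hα x
    rw [hb, Module.algebraMap_end_apply] at h1
    exact (smul_left_injective K ((splitBasis K n r h).ne_zero x) h1).symm
  have h1 := key (.inl ht.some)
  have h2 := key (.inr hf.some)
  exact (ne_one_of_lt_orderOf h hα).2 (h1.trans h2.symm)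

variable {n r : ℕ} {α : Kˣ} {hα : n < orderOf α}
  {R : BraidGroup n →* GL (Fin (c n r)) K}

lemma card_centralizer_σ_zero (h : 1 < n) (hR : IsMatrixFormOf R (twoRowRep n r α hα)) :
    Nat.card (Subgroup.centralizer {R (BraidGroup.σ ⟨0, by omega⟩)}) =
      Nat.card (GL (TableauWith n r h true) K) * Nat.card (GL (TableauWith n r h false) K) := by
  obtain ⟨b, hb⟩ := hR
  let e : GL (Fin (c n r)) K ≃* GL (TableauWith n r h true ⊕ TableauWith n r h false) K :=
    Units.mapEquiv ((LinearMap.toMatrixAlgEquiv b).symm.trans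
      (LinearMap.toMatrixAlgEquiv (splitBasis K n r h))).toMulEquiv
  rw [← card_centralizer_map e]
  refine card_centralizer_fromBlocks (ne_one_of_lt_orderOf h hα).2 _ ?_
  rw [← toMatrix_heckeOp_zero h α hα, ← twoRowRep_σ α hα]
  change LinearMap.toMatrixAlgEquiv (splitBasis K n r h) ((LinearMap.toMatrixAlgEquiv b).symm
    (R (BraidGroup.σ ⟨0, by omega⟩) : Matrix _ _ K)) = _
  rw [hb]
  exact congrArg (LinearMap.toMatrixAlgEquiv (splitBasis K n r h))
    ((LinearMap.toMatrixAlgEquiv b).symm_apply_apply _)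

lemma matrix_quadratic (hR : IsMatrixFormOf R (twoRowRep n r α hα)) (i : Fin (n - 1)) :
    ((R (BraidGroup.σ i) : Matrix (Fin (c n r)) (Fin (c n r)) K) + 1) *
      ((R (BraidGroup.σ i) : Matrix (Fin (c n r)) (Fin (c n r)) K) - algebraMap K _ (α : K)) =
      0 := by
  obtain ⟨b, hb⟩ := hR
  have h1 := congrArg (LinearMap.toMatrixAlgEquiv b) (hecke_quadratic (r := r) α hα i)
  rw [map_mul, map_add, map_one, map_zero] at h1
  have h2 := (map_sub (LinearMap.toMatrixAlgEquiv b) (heckeOp α r i) (algebraMap K _ (α : K))).trans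
    (congrArg _ ((LinearMap.toMatrixAlgEquiv b).commutes (α : K)))
  rw [hb, twoRowRep_σ]
  exact (congrArg _ h2.symm).trans h1

lemma matrix_σ_zero_ne_algebraMap (h : 1 < n) (hR : IsMatrixFormOf R (twoRowRep n r α hα))
    (ht : Nonempty (TableauWith n r h true)) (hf : Nonempty (TableauWith n r h false)) (a : K) :
    (R (BraidGroup.σ ⟨0, by omega⟩) : Matrix (Fin (c n r)) (Fin (c n r)) K) ≠
      algebraMap K _ a := by
  obtain ⟨b, hb⟩ := hR
  intro h1
  rw [hb, twoRowRep_σ] at h1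
  refine heckeOp_zero_ne_algebraMap h α hα ht hf a ((LinearMap.toMatrixAlgEquiv b).injective ?_)
  rw [AlgEquiv.commutes]
  exact h1

end FirstGenerator

end BraidTL

/-! ### Independence of the two representations -/

namespace BraidTL
open Matrix Matrix.SpecialLinearGroup

lemma c_zero (n : ℕ) : c n 0 = 1 := by
  have h := tableauCount_zero_formula (n := n) (r := 0) (d := n + 1) (by omega)
  rw [← c_eq_tableauCount, Nat.factorial_zero, one_mul, zero_add, Nat.factorial_succ,
    mul_comm n.factorial] at h
  exact Nat.eq_of_mul_eq_mul_right (by positivity) (h.trans (one_mul _).symm)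

lemma three_le_c {n r : ℕ} (hn : 5 ≤ n) (hr0 : r ≠ 0) (hr : 2 * r ≤ n) : 3 ≤ c n r := by
  obtain ⟨m, rfl⟩ : ∃ m, n = m + 2 := ⟨n - 2, by omega⟩
  obtain ⟨s, rfl⟩ : ∃ s, r = s + 1 := ⟨r - 1, by omega⟩
  have h1 := two_mul_tableauCount_lt (m := m) (s := s) (by omega) (by omega)
  have h2 := tableauCount_two_pos (m := m) (s := s) (by omega)
  omega

lemma nonempty_tableauWith {n r : ℕ} (hn : 5 ≤ n) (hr0 : r ≠ 0) (hr : 2 * r ≤ n) (h : 1 < n)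
    (b : Bool) : Nonempty (TableauWith n r h b) := by
  obtain ⟨m, rfl⟩ : ∃ m, n = m + 2 := ⟨n - 2, by omega⟩
  obtain ⟨s, rfl⟩ : ∃ s, r = s + 1 := ⟨r - 1, by omega⟩
  have h1 := two_mul_tableauCount_lt (m := m) (s := s) (by omega) (by omega)
  have h2 := tableauCount_two_pos (m := m) (s := s) (by omega)
  have h3 := card_tableauWith_add (m + 2) (s + 1) h
  have h4 := card_tableauWith_true (m + 2) (s + 1) h
  rw [← Fintype.card_pos_iff]
  cases b <;> omega

/-- The numbers `x` and `x + y` are determined by `(x + y) (x + y - 1)` and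
`x (x - 1) + y (y - 1)`, as soon as `x < y`. -/
lemma eq_of_mul_pred_eq {x y x' y' : ℕ} (h : x < y) (h' : x' < y')
    (h1 : (x + y) * (x + y - 1) = (x' + y') * (x' + y' - 1))
    (h2 : x * (x - 1) + y * (y - 1) = x' * (x' - 1) + y' * (y' - 1)) :
    x = x' ∧ y = y' := by
  have hcast : ∀ a : ℕ, ((a * (a - 1) : ℕ) : ℤ) = a * (a - 1) := by
    intro a
    cases a <;> simp
  zify at h1 h2
  have e1 := hcast (x + y)
  have e2 := hcast (x' + y')
  have e3 := hcast x
  have e4 := hcast y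
  have e5 := hcast x'
  have e6 := hcast y'
  push_cast at *
  rw [e1, e2] at h1
  rw [e3, e4, e5, e6] at h2
  have k1 : ((x : ℤ) + y - (x' + y')) * (x + y + (x' + y') - 1) = 0 := by linear_combination h1
  have k2 : (x : ℤ) + y = x' + y' := by
    rcases mul_eq_zero.mp k1 with k | k <;> omega
  have k3 : 2 * (((x : ℤ) - x') * (y - x')) = 0 := by
    have hy : (y' : ℤ) = x + y - x' := by omega
    rw [hy] at h2
    linear_combination -h2
  have k3 := (mul_eq_zero.mp k3).resolve_left two_ne_zero
  rcases mul_eq_zero.mp k3 with k | k <;> omega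

lemma isPerfect_c {n : ℕ} (hn : 5 ≤ n) {r : ℕ} (hr : 2 * r ≤ n) (K : Type*) [Field K] :
    Group.IsPerfect (SpecialLinearGroup (Fin (c n r)) K) := by
  by_cases hr0 : r = 0
  · subst hr0
    have : Subsingleton (Fin (c n 0)) := by rw [c_zero]; infer_instance
    infer_instance
  · exact isPerfect (by simpa using three_le_c hn hr0 hr)

section Independence

variable {K : Type*} [Field K] [Finite K] {n : ℕ} {α : Kˣ} {hα : n < orderOf α}

/-- The representations attached to two distinct two-row shapes do not become central on the same
elements of the commutator subgroup. Otherwise `SL_{N₁}(K)` and `SL_{N₂}(K)`, and likewise the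
centralizers of the images of `σ_0` in them, would have orders of the same `p`-adic valuation, and
these valuations determine `N` and the multiplicity of the eigenvalue `α` of `σ_0`. -/
lemma not_forall_center_iff (p : ℕ) [Fact p.Prime] [Algebra (ZMod p) K] (hn : 5 ≤ n) {r₁ r₂ : ℕ} (hr₁0 : r₁ ≠ 0) (hr₂0 : r₂ ≠ 0)
    (hr₁ : 2 * r₁ ≤ n) (hr₂ : 2 * r₂ ≤ n) (hr : r₁ ≠ r₂)
    {R₁ : BraidGroup n →* GL (Fin (c n r₁)) K} {R₂ : BraidGroup n →* GL (Fin (c n r₂)) K}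
    (hR₁ : IsMatrixFormOf R₁ (twoRowRep n r₁ α hα)) (hR₂ : IsMatrixFormOf R₂ (twoRowRep n r₂ α hα))
    {f₁ : commutator (BraidGroup n) →* SpecialLinearGroup (Fin (c n r₁)) K}
    {f₂ : commutator (BraidGroup n) →* SpecialLinearGroup (Fin (c n r₂)) K}
    (hf₁ : Function.Surjective f₁) (hf₂ : Function.Surjective f₂)
    (hfR₁ : ∀ g, toGL (f₁ g) = R₁ g) (hfR₂ : ∀ g, toGL (f₂ g) = R₂ g) :
    ¬ ∀ g, f₁ g ∈ Subgroup.center (SpecialLinearGroup (Fin (c n r₁)) K) ↔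
      f₂ g ∈ Subgroup.center (SpecialLinearGroup (Fin (c n r₂)) K) := by
  intro hZ
  have h1n : 1 < n := by omega
  obtain ⟨f, hf, hK⟩ := exists_card_eq_prime_pow p K
  -- Subgroups with the same preimage in the braid group have orders of the same `p`-adic valuation.
  have hval : ∀ (H₁ : Subgroup (GL (Fin (c n r₁)) K)) (H₂ : Subgroup (GL (Fin (c n r₂)) K)),
      Subgroup.center _ ≤ H₁ → Subgroup.center _ ≤ H₂ →
      (∀ g : commutator (BraidGroup n), R₁ g ∈ H₁ ↔ R₂ g ∈ H₂) →
      padicValNat p (Nat.card H₁) = padicValNat p (Nat.card H₂) := by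
    intro H₁ H₂ hH₁ hH₂ hH
    have h1 := card_mul_card_center_eq hf₁ hf₂ hZ (C₁ := H₁.comap toGL) (C₂ := H₂.comap toGL)
      (fun x hx => hH₁ ((toGL_mem_center_iff _).mpr hx)) (fun x hx => hH₂ ((toGL_mem_center_iff _).mpr hx))
      (fun g => by rw [Subgroup.mem_comap, Subgroup.mem_comap, hfR₁, hfR₂]; exact hH g)
    have h2 := congrArg (padicValNat p) h1
    rwa [padicValNat.mul Nat.card_pos.ne' Nat.card_pos.ne',
      padicValNat.mul Nat.card_pos.ne' Nat.card_pos.ne', padicValNat_card_center p K,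
      padicValNat_card_center p K, padicValNat_card_comap_toGL,
      padicValNat_card_comap_toGL] at h2
  have hcenter : ∀ (N : ℕ) (s : GL (Fin N) K),
      Subgroup.center (GL (Fin N) K) ≤ Subgroup.centralizer {s} := by
    intro N s
    exact Subgroup.center_le_centralizer _
  have hcomm : ∀ g : commutator (BraidGroup n),
      R₁ g ∈ Subgroup.centralizer {R₁ (BraidGroup.σ ⟨0, by omega⟩)} ↔
        R₂ g ∈ Subgroup.centralizer {R₂ (BraidGroup.σ ⟨0, by omega⟩)} := by
    intro g
    have hα1 := (ne_one_of_lt_orderOf h1n hα).1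
    have h1 := commute_iff_commutator_mem_center R₁ f₁ hfR₁ (BraidGroup.σ ⟨0, by omega⟩) hα1
      (matrix_quadratic hR₁ _) (matrix_σ_zero_ne_algebraMap h1n hR₁
        (nonempty_tableauWith hn hr₁0 hr₁ h1n _) (nonempty_tableauWith hn hr₁0 hr₁ h1n _)) g
    have h2 := commute_iff_commutator_mem_center R₂ f₂ hfR₂ (BraidGroup.σ ⟨0, by omega⟩) hα1
      (matrix_quadratic hR₂ _) (matrix_σ_zero_ne_algebraMap h1n hR₂
        (nonempty_tableauWith hn hr₂0 hr₂ h1n _) (nonempty_tableauWith hn hr₂0 hr₂ h1n _)) g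
    rw [Subgroup.mem_centralizer_singleton_iff, Subgroup.mem_centralizer_singleton_iff]
    exact h1.trans ((hZ _).trans h2.symm)
  have htop := hval ⊤ ⊤ le_top le_top (fun g => by simp)
  have hcen := hval _ _ (hcenter _ _) (hcenter _ _) hcomm
  rw [card_centralizer_σ_zero h1n hR₁, card_centralizer_σ_zero h1n hR₂,
    padicValNat.mul Nat.card_pos.ne' Nat.card_pos.ne',
    padicValNat.mul Nat.card_pos.ne' Nat.card_pos.ne'] at hcen
  rw [Nat.card_congr Subgroup.topEquiv.toEquiv, Nat.card_congr Subgroup.topEquiv.toEquiv] at htop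
  have hv₁ := two_mul_padicValNat_card_GL p hK (ι := Fin (c n r₁))
  have hv₂ := two_mul_padicValNat_card_GL p hK (ι := Fin (c n r₂))
  have hx₁ := two_mul_padicValNat_card_GL p hK (ι := TableauWith n r₁ h1n true)
  have hx₂ := two_mul_padicValNat_card_GL p hK (ι := TableauWith n r₂ h1n true)
  have hy₁ := two_mul_padicValNat_card_GL p hK (ι := TableauWith n r₁ h1n false)
  have hy₂ := two_mul_padicValNat_card_GL p hK (ι := TableauWith n r₂ h1n false)
  have ha₁ := card_tableauWith_add n r₁ h1n
  have ha₂ := card_tableauWith_add n r₂ h1n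
  have hk₁ := card_tableauWith_true n r₁ h1n
  have hk₂ := card_tableauWith_true n r₂ h1n
  rw [Fintype.card_fin] at hv₁ hv₂
  obtain ⟨m, rfl⟩ : ∃ m, n = m + 2 := ⟨n - 2, by omega⟩
  obtain ⟨s, rfl⟩ : ∃ s, r₁ = s + 1 := ⟨r₁ - 1, by omega⟩
  obtain ⟨t, rfl⟩ : ∃ t, r₂ = t + 1 := ⟨r₂ - 1, by omega⟩
  have hl₁ := two_mul_tableauCount_lt (m := m) (s := s) (by omega) (by omega)
  have hl₂ := two_mul_tableauCount_lt (m := m) (s := t) (by omega) (by omega)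
  have heq := eq_of_mul_pred_eq
    (x := Fintype.card (TableauWith (m + 2) (s + 1) h1n true))
    (y := Fintype.card (TableauWith (m + 2) (s + 1) h1n false))
    (x' := Fintype.card (TableauWith (m + 2) (t + 1) h1n true))
    (y' := Fintype.card (TableauWith (m + 2) (t + 1) h1n false))
    (by omega) (by omega)
    (by
      rw [ha₁, ha₂]
      refine Nat.eq_of_mul_eq_mul_left hf ?_
      rw [← hv₁, ← hv₂, htop])
    (by
      refine Nat.eq_of_mul_eq_mul_left hf ?_
      rw [mul_add, mul_add, ← hx₁, ← hx₂, ← hy₁, ← hy₂, ← mul_add, ← mul_add, hcen])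
  have := eq_of_c_eq (m := m) (s := s) (t := t) (by omega) (by omega) (by omega) (by omega)
  omega

/-- The commutator subgroup of the braid group maps onto the product of the two special linear
groups. -/
lemma surjective_prod (p : ℕ) [Fact p.Prime] [Algebra (ZMod p) K] (hn : 5 ≤ n) {r₁ r₂ : ℕ}
    (hr₁ : 2 * r₁ ≤ n) (hr₂ : 2 * r₂ ≤ n) (hr : r₁ ≠ r₂)
    {R₁ : BraidGroup n →* GL (Fin (c n r₁)) K} {R₂ : BraidGroup n →* GL (Fin (c n r₂)) K}
    (hR₁ : IsMatrixFormOf R₁ (twoRowRep n r₁ α hα)) (hR₂ : IsMatrixFormOf R₂ (twoRowRep n r₂ α hα))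
    {f₁ : commutator (BraidGroup n) →* SpecialLinearGroup (Fin (c n r₁)) K}
    {f₂ : commutator (BraidGroup n) →* SpecialLinearGroup (Fin (c n r₂)) K}
    (hf₁ : Function.Surjective f₁) (hf₂ : Function.Surjective f₂)
    (hfR₁ : ∀ g, toGL (f₁ g) = R₁ g) (hfR₂ : ∀ g, toGL (f₂ g) = R₂ g) :
    Function.Surjective (f₁.prod f₂) := by
  -- The shape `[n]` gives the trivial group `SL_1(K)`.
  by_cases hr₁0 : r₁ = 0
  · subst hr₁0
    have : Subsingleton (Fin (c n 0)) := by rw [c_zero]; infer_instance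
    rintro ⟨A, B⟩
    obtain ⟨g, rfl⟩ := hf₂ B
    exact ⟨g, Prod.ext (Subsingleton.elim _ _) rfl⟩
  by_cases hr₂0 : r₂ = 0
  · subst hr₂0
    have : Subsingleton (Fin (c n 0)) := by rw [c_zero]; infer_instance
    rintro ⟨A, B⟩
    obtain ⟨g, rfl⟩ := hf₁ A
    exact ⟨g, Prod.ext rfl (Subsingleton.elim _ _)⟩
  have h₁ : 3 ≤ Fintype.card (Fin (c n r₁)) := by simpa using three_le_c hn hr₁0 hr₁
  have h₂ : 3 ≤ Fintype.card (Fin (c n r₂)) := by simpa using three_le_c hn hr₂0 hr₂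
  have := isPerfect (F := K) h₁
  have := isPerfect (F := K) h₂
  exact (surjective_prod_or_center_iff (fun M _ => eq_top_or_le_center h₁ M)
    (fun M _ => eq_top_or_le_center h₂ M) hf₁ hf₂).resolve_right
    (not_forall_center_iff p hn hr₁0 hr₂0 hr₁ hr₂ hr hR₁ hR₂ hf₁ hf₂ hfR₁ hfR₂)

end Independence

end BraidTL

open BraidTL IntermediateField in
theorem proposition3p1 (p : ℕ) [Fact p.Prime] (K : Type*) [Field K] [Finite K] [Algebra (ZMod p) K]
    (n : ℕ) (hn : 5 ≤ n) (α : Kˣ) (hα : n < orderOf α)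
    (hK : (ZMod p)⟮(α : K)⟯ = ⊤)
    (hαα : (ZMod p)⟮(α : K)⟯ = (ZMod p)⟮(α : K) + (α : K)⁻¹⟯)
    (r₁ r₂ : ℕ) (hr₁ : 2 * r₁ ≤ n) (hr₂ : 2 * r₂ ≤ n) (hr : r₁ ≠ r₂)
    (R₁ : BraidGroup n →* Matrix.GeneralLinearGroup (Fin (c n r₁)) K)
    (R₂ : BraidGroup n →* Matrix.GeneralLinearGroup (Fin (c n r₂)) K)
    (hR₁ : IsMatrixFormOf R₁ (twoRowRep n r₁ α hα))
    (hR₂ : IsMatrixFormOf R₂ (twoRowRep n r₂ α hα))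
    (hSL₁ : SLSubgroup (c n r₁) K ≤ R₁.range)
    (hSL₂ : SLSubgroup (c n r₂) K ≤ R₂.range) :
    (SLSubgroup (c n r₁) K).prod (SLSubgroup (c n r₂) K) ≤ (R₁.prod R₂).range := by
  have := isPerfect_c hn hr₁ K
  have := isPerfect_c hn hr₂ K
  obtain ⟨f₁, hf₁, hfR₁⟩ := exists_commutator_surjective_specialLinearGroup R₁ hSL₁
  obtain ⟨f₂, hf₂, hfR₂⟩ := exists_commutator_surjective_specialLinearGroup R₂ hSL₂
  rintro ⟨_, _⟩ ⟨⟨A, rfl⟩, ⟨B, rfl⟩⟩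
  obtain ⟨g, hg⟩ := surjective_prod p hn hr₁ hr₂ hr hR₁ hR₂ hf₁ hf₂ hfR₁ hfR₂ (A, B)
  refine ⟨g, Prod.ext ?_ ?_⟩
  · exact (hfR₁ g).symm.trans (congrArg (fun x => Matrix.SpecialLinearGroup.toGL x.1) hg)
  · exact (hfR₂ g).symm.trans (congrArg (fun x => Matrix.SpecialLinearGroup.toGL x.2) hg)
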